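/- For $n\ge 0$, an \emph{increasing ordered tree} on $n+1$ nodes is a rooted tree with nodes labeled $0,1,\dots,n$, with labels increasing along every path from the root to a leaf (so the root is $0$), together with a total order on the children of each node. It is \emph{$1$-flourishing} if the root has at least one child and the first child of the root is not a leaf. For a partition $\pi=\pi_1\mid\cdots\mid\pi_k$ of $[n]=\{1,\dots,n\}$ let $k$ be its number of blocks, $s$ its number of nonsingleton blocks, and $f(\pi)=s\cdot(k-1)!$ (read as $0$ when $k=0$). We use the convention $(-1)!!=1$. Let $[[n]]=\{1,\bar 1,\dots,n,\bar n\}$ with the involution $i\leftrightarrow\bar i$, and let $\sigma$ be a single sign. A $\{\sigma\}$-labeled partition of $[[n]]$ is a partition of $[[n]]$ into nonempty blocks such that $\bar R$ is a block whenever $R$ is, and at most one block satisfies $S=\bar S$; this block, if it exists, carries the sign $\sigma$ and is called signed, and all other blocks are unsigned. These partitions are ordered by refinement, where $x\preceq y$ requires that the signed block of $x$ (if any) is contained in the signed block of $y$, and that for each unsigned block $R$ of $x$ there are blocks $T,\bar T$ of $y$ with $R\subseteq T$, $\bar R\subseteq\bar T$. The \emph{linear type $D_n$ poset} is the subposet of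 those partitions whose signed block does not have exactly two elements. Its bottom $\hat 0$ is the partition into singletons, and $[n]_\sigma$ denotes the partition with the single (signed) block $[[n]]$. The representative of a block $R$ is the least $i\in[n]$ with $i\in R$ or $\bar i\in R$; $R$ is normalized if its representative lies in $R$. Label an edge $x\prec\!\cdot\, y$ of the Hasse diagram by $(0,\max(i,j))$ if $R\cup R'\in y$ for distinct normalized unsigned blocks $R,R'$ of $x$ with representatives $i,j$; by $(2,\min(i,j))$ if $R\cup\overline{R'}\in y$ for such $R,R'$; and by $(1,1)$ if the signed block of $x$ (empty if there is none) is strictly contained in that of $y$. Order labels lexicographically. A maximal chain $x\prec\!\cdot\, z_1\prec\!\cdot\cdots\prec\!\cdot\, z_t\prec\!\cdot\, y$ from $x$ to $y$ is \emph{decreasing} if its sequence of labels is weakly decreasing. \textbf{Proposition.} For every $n\ge 0$, \[ \sum_{\pi=\pi_1\mid\cdots\mid\pi_k} f(\pi)\,(2|\pi_1|-3)!!\cdots(2|\pi_k|-3)!!, \] the sum being over all partitions $\pi$ of $[n]$, is the number of $1$-flourishing increasing ordered trees on $n+1$ nodes. Moreover, for every $n\ge 1$, the number of decreasing maximal chains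 from $\hat 0$ to $[n]_\sigma$ in the linear type $D_n$ poset is $(2n-3)!!\,(n-1)$. (For $n=1$ both are $0$, as $[1]_\sigma$ does not belong to the poset.) -/

import Mathlib

open scoped Nat

/-! ## Labeled partitions of `[[n]]` -/

/-- The set `[[n]] = {1, 1̄, …, n, n̄}`: the pair `(i, false)` stands for the element `i + 1` and
`(i, true)` for its barred copy. -/
abbrev BarSet (n : ℕ) : Type := Fin n × Bool

/-- The involution `i ↦ ī`, `ī ↦ i` of `[[n]]`. -/
def barElt {n : ℕ} (a : BarSet n) : BarSet n := (a.1, !a.2)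

/-- The image of a subset of `[[n]]` under the involution. -/
def barImage {n : ℕ} (X : Finset (BarSet n)) : Finset (BarSet n) := X.image barElt

/-- An `S`-labeled partition of `[[n]]`: a partition into nonempty blocks, together with an
injective labeling by `S` of some of the blocks (`sign B = some σ` means that the block `B` carries
the sign `σ`, `sign B = none` that it is unsigned; `sign` is `none` on sets which are not blocks),
such that the set of blocks is closed under the involution, and the signed blocks are exactly the
blocks fixed by the involution. -/
@[ext]
structure LabeledPartition (n : ℕ) (S : Type*) where
  toPartition : Finpartition (Finset.univ : Finset (BarSet n))
  sign : Finset (BarSet n) → Option S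
  sign_eq_none : ∀ B, B ∉ toPartition.parts → sign B = none
  sign_injective : ∀ B C σ, sign B = some σ → sign C = some σ → B = C
  bar_mem : ∀ B ∈ toPartition.parts, barImage B ∈ toPartition.parts
  bar_eq_iff : ∀ B ∈ toPartition.parts, barImage B = B ↔ ∃ σ, sign B = some σ

namespace LabeledPartition

variable {n : ℕ} {S : Type*}

/-- The blocks of a labeled partition. -/
def blocks (x : LabeledPartition n S) : Finset (Finset (BarSet n)) := x.toPartition.parts

/-- `R` is an unsigned block of `x`. -/
def IsUnsignedBlock (x : LabeledPartition n S) (R : Finset (BarSet n)) : Prop :=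
  R ∈ x.blocks ∧ x.sign R = none

/-- The set `Σ(x)` of the signs carried by the blocks of `x`. -/
def signs (x : LabeledPartition n S) : Set S := {σ | ∃ B, x.sign B = some σ}

open Classical in
/-- `x_σ`, the block of `x` of sign `σ`; it is the empty set if `σ` is not a sign of `x`. -/
noncomputable def signedBlock (x : LabeledPartition n S) (σ : S) : Finset (BarSet n) :=
  (x.blocks.filter fun B => x.sign B = some σ).biUnion id

/-- Refinement: the block of sign `σ` of `x` is contained in the block of sign `σ` of `y`, and for
every unsigned block `R` of `x` there are blocks `T` and `T̄` of `y` with `R ⊆ T` and `R̄ ⊆ T̄`. -/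
def Refines (x y : LabeledPartition n S) : Prop :=
  (∀ σ ∈ x.signs, σ ∈ y.signs ∧ x.signedBlock σ ⊆ y.signedBlock σ) ∧
  ∀ R, x.IsUnsignedBlock R →
    ∃ T, T ∈ y.blocks ∧ barImage T ∈ y.blocks ∧ R ⊆ T ∧ barImage R ⊆ barImage T

theorem mem_blocks_of_sign {x : LabeledPartition n S} {B : Finset (BarSet n)} {σ : S}
    (h : x.sign B = some σ) : B ∈ x.blocks := by
  by_contra hB
  simp [x.sign_eq_none B hB] at h

theorem signedBlock_eq {x : LabeledPartition n S} {B : Finset (BarSet n)} {σ : S}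
    (h : x.sign B = some σ) : x.signedBlock σ = B := by
  classical
  ext a
  simp only [signedBlock, Finset.mem_biUnion, Finset.mem_filter, id]
  constructor
  · rintro ⟨C, ⟨-, hC⟩, ha⟩
    rwa [x.sign_injective B C σ h hC]
  · intro ha
    exact ⟨B, ⟨mem_blocks_of_sign h, h⟩, ha⟩

theorem Refines.exists_subset {x y : LabeledPartition n S} (h : x.Refines y)
    {B : Finset (BarSet n)} (hB : B ∈ x.blocks) : ∃ C ∈ y.blocks, B ⊆ C := by
  cases hs : x.sign B with
  | none =>
    obtain ⟨T, hT, -, hBT, -⟩ := h.2 B ⟨hB, hs⟩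
    exact ⟨T, hT, hBT⟩
  | some σ =>
    obtain ⟨⟨C, hC⟩, hsub⟩ := h.1 σ ⟨B, hs⟩
    rw [signedBlock_eq hs, signedBlock_eq hC] at hsub
    exact ⟨C, mem_blocks_of_sign hC, hsub⟩

theorem Refines.toPartition_le {x y : LabeledPartition n S} (h : x.Refines y) :
    x.toPartition ≤ y.toPartition :=
  fun _ hB => h.exists_subset hB

/-- Labeled partitions are partially ordered by refinement. -/
instance : PartialOrder (LabeledPartition n S) where
  le := Refines
  le_refl x := ⟨fun _ hσ => ⟨hσ, subset_rfl⟩,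
    fun R hR => ⟨R, hR.1, x.bar_mem R hR.1, subset_rfl, subset_rfl⟩⟩
  le_trans x y z hxy hyz := by
    refine ⟨fun σ hσ => ⟨(hyz.1 σ (hxy.1 σ hσ).1).1,
      (hxy.1 σ hσ).2.trans (hyz.1 σ (hxy.1 σ hσ).1).2⟩, fun R hR => ?_⟩
    obtain ⟨T, hT, -, hRT, -⟩ := hxy.2 R hR
    obtain ⟨U, hU, hTU⟩ := hyz.exists_subset hT
    exact ⟨U, hU, z.bar_mem U hU, hRT.trans hTU, Finset.image_subset_image (hRT.trans hTU)⟩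
  le_antisymm x y hxy hyx := by
    have hp : x.toPartition = y.toPartition := le_antisymm hxy.toPartition_le hyx.toPartition_le
    have key : ∀ {x y : LabeledPartition n S}, x.Refines y → y.Refines x →
        ∀ B σ, x.sign B = some σ → y.sign B = some σ := by
      intro x y hxy hyx B σ hB
      obtain ⟨⟨C, hC⟩, h1⟩ := hxy.1 σ ⟨B, hB⟩
      have h2 := (hyx.1 σ ⟨C, hC⟩).2
      rw [signedBlock_eq hB, signedBlock_eq hC] at h1 h2
      rw [subset_antisymm h1 h2, hC]
    refine LabeledPartition.ext hp (funext fun B => ?_)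
    exact Option.ext fun σ => ⟨key hxy hyx B σ, key hyx hxy B σ⟩

/-- The finest labeled partition `0̂ = 1 | 1̄ | ⋯ | n | n̄`. -/
def zeroHat (n : ℕ) (S : Type*) : LabeledPartition n S where
  toPartition := ⊥
  sign _ := none
  sign_eq_none _ _ := rfl
  sign_injective _ _ _ h := by simp at h
  bar_mem B hB := by
    rw [Finpartition.mem_bot_iff] at hB ⊢
    obtain ⟨a, -, rfl⟩ := hB
    exact ⟨barElt a, Finset.mem_univ _, by simp [barImage]⟩
  bar_eq_iff B hB := by
    rw [Finpartition.mem_bot_iff] at hB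
    obtain ⟨a, -, rfl⟩ := hB
    simp [barImage, barElt, Prod.ext_iff]

theorem univ_ne_bot (hn : 1 ≤ n) : (Finset.univ : Finset (BarSet n)) ≠ ⊥ := by
  intro h
  exact Finset.notMem_empty ((⟨0, hn⟩, false) : BarSet n)
    (Finset.bot_eq_empty ▸ h ▸ Finset.mem_univ _)

theorem barImage_univ : barImage (Finset.univ : Finset (BarSet n)) = Finset.univ :=
  Finset.image_univ_of_surjective fun a => ⟨barElt a, by simp [barElt]⟩

open Classical in
/-- The labeled partition `[n]_σ` (for `n ≥ 1`), with the single block `[[n]]`, of sign `σ`. -/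
noncomputable def full (hn : 1 ≤ n) (σ : S) : LabeledPartition n S where
  toPartition := Finpartition.indiscrete (univ_ne_bot hn)
  sign B := if B = Finset.univ then some σ else none
  sign_eq_none B hB := by simpa using hB
  sign_injective B C τ hB hC := by
    split_ifs at hB hC with h1 h2
    rw [h1, h2]
  bar_mem B hB := by
    simp only [Finpartition.indiscrete_parts, Finset.mem_singleton] at hB ⊢
    rw [hB, barImage_univ]
  bar_eq_iff B hB := by
    simp only [Finpartition.indiscrete_parts, Finset.mem_singleton] at hB
    simp [hB, barImage_univ]

/-! ## The edge labeling -/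

/-- The representative of a (nonempty) block `R`: the minimum `i ∈ {1, …, n}` such that `i ∈ R` or
`ī ∈ R`. -/
noncomputable def representative (R : Finset (BarSet n)) : ℕ :=
  sInf {i : ℕ | ∃ a ∈ R, (a.1 : ℕ) + 1 = i}

/-- `R` is normalized if its representative belongs to `R` (and not only its barred copy). -/
def IsNormalized (R : Finset (BarSet n)) : Prop :=
  ∃ a ∈ R, a.2 = false ∧ (a.1 : ℕ) + 1 = representative R

/-- The edge from `x` to `y` is coherent, merging the distinct normalized unsigned blocks `R` and
`R'` of `x` into the block `R ∪ R'` of `y`. -/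
def IsCoherentMerge (x y : LabeledPartition n S) (R R' : Finset (BarSet n)) : Prop :=
  R ≠ R' ∧ x.IsUnsignedBlock R ∧ x.IsUnsignedBlock R' ∧ IsNormalized R ∧ IsNormalized R' ∧
    R ∪ R' ∈ y.blocks

/-- The edge from `x` to `y` is non-coherent, merging, for distinct normalized unsigned blocks `R`
and `R'` of `x`, the blocks `R` and `R̄'` into the block `R ∪ R̄'` of `y`. -/
def IsNonCoherentMerge (x y : LabeledPartition n S) (R R' : Finset (BarSet n)) : Prop :=
  R ≠ R' ∧ x.IsUnsignedBlock R ∧ x.IsUnsignedBlock R' ∧ IsNormalized R ∧ IsNormalized R' ∧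
    R ∪ barImage R' ∈ y.blocks

open Classical in
/-- The second component of the label of an edge of sign `σ` that starts at `x`. -/
noncomputable def signRank [LinearOrder S] (x : LabeledPartition n S) (σ : S) : ℕ :=
  if σ ∈ x.signs then (x.signs ∩ Set.Iic σ).ncard else (Set.Iic σ ∪ x.signs).ncard

open Classical in
/-- The label of the edge from `x` to `y`, in the lexicographic order on pairs of natural numbers.
An edge of the Hasse diagram is of exactly one of the three types (coherent, non-coherent, of sign
`σ`), and the representatives are determined up to order, so the choices do not matter. The value
`(0, 0)` is never taken on an edge. -/
noncomputable def edgeLabel [LinearOrder S] (x y : LabeledPartition n S) : ℕ ×ₗ ℕ :=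
  if h : ∃ p : Finset (BarSet n) × Finset (BarSet n), IsCoherentMerge x y p.1 p.2 then
    toLex (0, max (representative h.choose.1) (representative h.choose.2))
  else if h : ∃ p : Finset (BarSet n) × Finset (BarSet n), IsNonCoherentMerge x y p.1 p.2 then
    toLex (2, min (representative h.choose.1) (representative h.choose.2))
  else if h : ∃ σ, x.signedBlock σ ⊂ y.signedBlock σ then
    toLex (1, signRank x h.choose)
  else toLex (0, 0)

/-! ## Decreasing chains -/

/-- The poset of `S`-labeled partitions of type `D_n`, as a set of labeled partitions: no signed
block has exactly two elements, that is, is of the form `{i, ī}`. -/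
def typeD (n : ℕ) (S : Type*) : Set (LabeledPartition n S) :=
  {x | ∀ σ, (x.signedBlock σ).card ≠ 2}

/-- The word of labels along a chain. -/
noncomputable def word [LinearOrder S] (c : List (LabeledPartition n S)) : List (ℕ ×ₗ ℕ) :=
  List.zipWith edgeLabel c c.tail

/-- The decreasing maximal chains from `x` to `y` in the subposet `P`: the chains
`x ⋖ z₁ ⋖ ⋯ ⋖ zₜ ⋖ y` of elements of `P`, each covered by the next one in `P`, whose word of labels
is weakly decreasing. -/
def decreasingMaximalChains [LinearOrder S] (P : Set (LabeledPartition n S))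
    (x y : LabeledPartition n S) : Set (List P) :=
  {c | c.IsChain (fun a b => a ⋖ b) ∧
    (c.map Subtype.val).head? = some x ∧ (c.map Subtype.val).getLast? = some y ∧
    (word (c.map Subtype.val)).Pairwise (fun a b => b ≤ a)}

end LabeledPartition

/-! ## Increasing ordered trees -/

/-- An increasing ordered tree with nodes labeled `0, 1, …, n`, given by the ordered list of the
children of each node. The root is `0`, every other node is a child of exactly one node, and each
node is smaller than its children; so all nodes are descendants of the root, and the labels increase
along every path from the root. -/
@[ext]
structure IncreasingOrderedTree (n : ℕ) where
  children : Fin (n + 1) → List (Fin (n + 1))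
  nodup : ∀ v, (children v).Nodup
  lt_of_mem : ∀ v, ∀ w ∈ children v, v < w
  existsUnique_parent : ∀ w, w ≠ 0 → ∃! v, w ∈ children v

/-- An increasing ordered tree is `r`-flourishing if the root has at least `r` children and none of
the first `r` children of the root is a leaf. -/
def IncreasingOrderedTree.IsFlourishing {n : ℕ} (T : IncreasingOrderedTree n) (r : ℕ) : Prop :=
  r ≤ (T.children 0).length ∧ ∀ v ∈ (T.children 0).take r, T.children v ≠ []

/-! ## The formula -/

/-- The partitions of `[n]`. -/
abbrev SetPartition (n : ℕ) : Type := Finpartition (Finset.univ : Finset (Fin n))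

/-- The number `k` of blocks of a partition. -/
def SetPartition.numBlocks {n : ℕ} (π : SetPartition n) : ℕ := π.parts.card

/-- The number `s` of nonsingleton blocks of a partition. -/
def SetPartition.numNonsingletonBlocks {n : ℕ} (π : SetPartition n) : ℕ :=
  (π.parts.filter fun B => B.card ≠ 1).card

/-- The sum `∑ f(π) (2|π₁| - 3)!! ⋯ (2|πₖ| - 3)!!` over all partitions `π = π₁ | ⋯ | πₖ` of `[n]`.
For a singleton block the truncated `2 * 1 - 3 = 0` has `0‼ = 1`, which agrees with the convention
`(-1)!! = 1`. -/
def chainFormula (n : ℕ) (f : SetPartition n → ℕ) : ℕ :=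
  ∑ π : SetPartition n, f π * ∏ B ∈ π.parts, (2 * B.card - 3)‼

/-- The function `f(π) = s · (k - 1)!` (for `k = 0`, it is `0` since `s = 0`). -/
def linearDWeight {n : ℕ} (π : SetPartition n) : ℕ :=
  π.numNonsingletonBlocks * (π.numBlocks - 1)!

/-! ## Partitions of a set with one more element -/

namespace Finpartition

variable {α : Type*} [DecidableEq α] {s : Finset α} {a : α}

/-! All three counts equal $(2n-3)!!\,(n-1)$ for $n\ge 1$; they are evaluated separately and no
bijection between them is built.

Formula and trees grow by one element. Put $W(\pi)=\prod(2|\pi_i|-3)!!$. Joining a new element to a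
block $B$ multiplies $W$ by $2|B|-1$, and $\sum_B(2|B|-1)=2n-k$. This yields $\sum k!\,W=(2n-1)!!$,
and for the weight $s(k-1)!$ the recursion $a_{n+1}=(2n-1)a_n+(2n-1)!!$ for $n\ge 1$
(`sum_linearDWeight_insert`). A tree on $n+1$ nodes has $2n+1$ places for a new largest leaf. A
flourishing tree stays flourishing at all places but one, and a non-flourishing one becomes
flourishing at exactly one place (`card_flourishing_positions`): the same recursion.

Chains: the edge into $[n]_\sigma$ has label at least $(1,1)$, so a decreasing chain has no coherent
merges. It consists of non-coherent merges with weakly decreasing smaller representatives, followed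
by absorptions of pairs $B,\bar B$ into the signed block. The first absorption must take a
nonsingleton, since a signed block of two elements is forbidden (`covBy_cases`). So an unsigned
partition with $k$ pairs of blocks, $t$ of them nonsingleton, has $t(k-1)!$ ways to finish by
absorptions. The merges are counted by recursion on an upper bound $(2,i)$ for the next label: the
count depends only on $i$, the number $m$ of representatives beyond the bound and, linearly, on the
nonsingleton blocks (`encard_chainsFrom_Iic`). The coefficients have the closed forms `bigCoeff_mul`
and `constCoeff_mul`. -/

theorem erase_of_mem_parts (P : Finpartition s) (ha : a ∉ s) {B : Finset α} (hB : B ∈ P.parts) :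
    B.erase a = B :=
  Finset.erase_eq_of_notMem fun h => ha (P.subset hB h)

/-- Add the element `a` to the block `B` of a partition. -/
def insertInto (P : Finpartition s) (ha : a ∉ s) (B : P.parts) : Finpartition (insert a s) :=
  Finpartition.ofExistsUnique (insert (insert a B.1) (P.parts.erase B.1))
    (by
      intro C hC
      rw [Finset.mem_insert, Finset.mem_erase] at hC
      rcases hC with rfl | hC
      · exact Finset.insert_subset_insert _ (P.subset B.2)
      · exact (P.subset hC.2).trans (Finset.subset_insert _ _))
    (by
      intro b hb
      have hB := B.2
      by_cases hbB : b ∈ insert a B.1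
      · refine ⟨insert a B.1, ⟨Finset.mem_insert_self _ _, hbB⟩, fun C hC => ?_⟩
        rcases Finset.mem_insert.1 hC.1 with h | h
        · exact h
        · exfalso
          have hC' := (Finset.mem_erase.1 h)
          rcases Finset.mem_insert.1 hbB with rfl | hb'
          · exact ha (P.subset hC'.2 hC.2)
          · exact hC'.1 (P.eq_of_mem_parts hC'.2 hB hC.2 hb')
      · have hbs : b ∈ s := by
          rcases Finset.mem_insert.1 hb with rfl | h
          · exact absurd (Finset.mem_insert_self _ _) hbB
          · exact h
        obtain ⟨C, hC, hbC⟩ := P.exists_mem hbs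
        refine ⟨C, ⟨Finset.mem_insert_of_mem (Finset.mem_erase.2 ⟨?_, hC⟩), hbC⟩, fun D hD => ?_⟩
        · rintro rfl
          exact hbB (Finset.mem_insert_of_mem hbC)
        · rcases Finset.mem_insert.1 hD.1 with h | h
          · exact absurd (h ▸ hD.2) hbB
          · exact P.eq_of_mem_parts (Finset.mem_erase.1 h).2 hC hD.2 hbC)
    (by
      rw [Finset.mem_insert, Finset.mem_erase, not_or]
      exact ⟨(Finset.insert_ne_empty _ _).symm, fun h => P.empty_notMem_parts h.2⟩)

/-- Add the element `a` to a partition, as a new singleton block or in an old block. -/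
def insertElement (ha : a ∉ s) (p : Σ P : Finpartition s, Option P.parts) :
    Finpartition (insert a s) :=
  match p with
  | ⟨P, none⟩ => P.extend (b := {a}) (Finset.singleton_ne_empty a)
      (Finset.disjoint_singleton_right.2 ha) (by rw [Finset.sup_eq_union, Finset.union_comm]; rfl)
  | ⟨P, some B⟩ => P.insertInto ha B

/-- Recovers `p.1` from the enlarged partition; the empty set thrown away is what is left of the
block `{a}`. Together with `part_insertElement` this makes the insertion injective. -/
theorem image_erase_parts_insertElement (ha : a ∉ s) (p : Σ P : Finpartition s, Option P.parts) :
    ((insertElement ha p).parts.image (·.erase a)).erase ∅ = p.1.parts := by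
  obtain ⟨P, o⟩ := p
  have key : ∀ X ⊆ P.parts, X.image (·.erase a) = X := fun X hX => by
    conv_rhs => rw [← Finset.image_id (s := X)]
    exact Finset.image_congr fun C hC => P.erase_of_mem_parts ha (hX hC)
  cases o with
  | none =>
    change ((insert {a} P.parts).image (·.erase a)).erase ∅ = _
    rw [Finset.image_insert, key _ subset_rfl, Finset.erase_singleton,
      Finset.erase_insert P.empty_notMem_parts]
  | some B =>
    change ((insert (insert a B.1) (P.parts.erase B.1)).image (·.erase a)).erase ∅ = _
    rw [Finset.image_insert, key _ (Finset.erase_subset _ _),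
      Finset.erase_insert fun h => ha (P.subset B.2 h), Finset.insert_erase B.2,
      Finset.erase_eq_of_notMem P.empty_notMem_parts]

theorem part_insertElement (ha : a ∉ s) (p : Σ P : Finpartition s, Option P.parts) :
    (insertElement ha p).part a = insert a (p.2.elim ∅ (·.1)) := by
  obtain ⟨P, o⟩ := p
  apply part_eq_of_mem _ _ (Finset.mem_insert_self _ _)
  cases o with
  | none => exact Finset.mem_insert_self _ _
  | some B => exact Finset.mem_insert_self _ _

theorem insertElement_bijective (ha : a ∉ s) :
    Function.Bijective (insertElement (s := s) ha) := by
  constructor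
  · rintro ⟨P, o⟩ ⟨P', o'⟩ h
    have h1 := image_erase_parts_insertElement ha ⟨P, o⟩
    rw [h, image_erase_parts_insertElement] at h1
    obtain rfl : P = P' := Finpartition.ext h1.symm
    have h2 := part_insertElement ha ⟨P, o⟩
    rw [h, part_insertElement] at h2
    have hn : ∀ o : Option P.parts, a ∉ o.elim ∅ (·.1) := by
      rintro (_ | B)
      · simp
      · exact fun h => ha (P.subset B.2 h)
    have h3 := congrArg (·.erase a) h2
    simp only [Finset.erase_insert (hn _)] at h3
    congr 1
    -- The absent block is encoded by the empty set, which is never a block, so `none` and `some`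
    -- cannot agree.
    match o, o', h3 with
    | none, none, _ => rfl
    | none, some B, h3 => exact absurd h3 (P.ne_empty B.2)
    | some B, none, h3 => exact absurd h3.symm (P.ne_empty B.2)
    | some B, some C, h3 => rw [Subtype.ext (h3.symm : B.1 = C.1)]
  · intro Q
    have hs : insert a s \ {a} = s := by
      rw [Finset.insert_sdiff_of_mem _ (Finset.mem_singleton_self a), Finset.sdiff_singleton_eq_erase,
        Finset.erase_eq_of_notMem ha]
    -- The preimage: `a` is removed from its block, and the block disappears if it was `{a}`.
    set P : Finpartition s := (Q.avoid {a}).copy hs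
    have mem_P : ∀ C, C ∈ P.parts ↔ ∃ D ∈ Q.parts, D ≠ {a} ∧ D.erase a = C := by
      intro C
      change C ∈ (Q.avoid {a}).parts ↔ _
      rw [mem_avoid]
      refine exists_congr fun D => and_congr_right fun hD => ?_
      rw [Finset.sdiff_singleton_eq_erase, Finset.subset_singleton_iff]
      simp [Q.ne_empty hD]
    have haQ : a ∈ Q.part a := Q.mem_part_self.2 (Finset.mem_insert_self _ _)
    have hQa : Q.part a ∈ Q.parts := Q.part_mem.2 (Finset.mem_insert_self _ _)
    have other : ∀ D ∈ Q.parts, D ≠ Q.part a → a ∉ D := fun D hD h haD =>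
      h (Q.part_eq_of_mem hD haD).symm
    by_cases h : Q.part a = {a}
    · refine ⟨⟨P, none⟩, Finpartition.ext ?_⟩
      change insert {a} P.parts = _
      ext C
      rw [Finset.mem_insert, mem_P]
      constructor
      · rintro (rfl | ⟨D, hD, hDa, rfl⟩)
        · exact h ▸ hQa
        · rwa [Finset.erase_eq_of_notMem (other D hD (h ▸ hDa))]
      · intro hC
        by_cases hCa : C = {a}
        · exact Or.inl hCa
        · exact Or.inr ⟨C, hC, hCa, Finset.erase_eq_of_notMem (other C hC (h ▸ hCa))⟩
    · refine ⟨⟨P, some ⟨(Q.part a).erase a, (mem_P _).2 ⟨_, hQa, h, rfl⟩⟩⟩, Finpartition.ext ?_⟩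
      change insert (insert a ((Q.part a).erase a)) (P.parts.erase ((Q.part a).erase a)) = _
      rw [Finset.insert_erase haQ]
      ext C
      rw [Finset.mem_insert, Finset.mem_erase, mem_P]
      constructor
      · rintro (rfl | ⟨hne, D, hD, hDa, rfl⟩)
        · exact hQa
        · rwa [Finset.erase_eq_of_notMem (other D hD fun h' => hne (h' ▸ rfl))]
      · intro hC
        by_cases hCa : C = Q.part a
        · exact Or.inl hCa
        · refine Or.inr ⟨fun h' => ?_, C, hC, ?_, Finset.erase_eq_of_notMem (other C hC hCa)⟩
          · obtain ⟨b, hb⟩ := Q.nonempty_of_mem_parts hC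
            exact hCa (Q.eq_of_mem_parts hC hQa hb (Finset.mem_of_mem_erase (h' ▸ hb)))
          · rintro rfl
            exact hCa (Q.part_eq_of_mem hC (Finset.mem_singleton_self a)).symm

/-- A sum over the partitions of `s ∪ {a}`, by removing `a`. -/
theorem sum_parts_insert (ha : a ∉ s) (Φ : Finset (Finset α) → ℕ) :
    ∑ Q : Finpartition (insert a s), Φ Q.parts =
      ∑ P : Finpartition s, (Φ (insert {a} P.parts) +
        ∑ B ∈ P.parts, Φ (insert (insert a B) (P.parts.erase B))) := by
  rw [← Fintype.sum_bijective _ (insertElement_bijective ha)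
    (fun p => Φ (insertElement ha p).parts) _ fun _ => rfl, Fintype.sum_sigma]
  refine Finset.sum_congr rfl fun P _ => ?_
  rw [Fintype.sum_option]
  exact congrArg _ (Finset.sum_coe_sort P.parts
    fun B => Φ (insert (insert a B) (P.parts.erase B)))

end Finpartition

/-! ## Evaluation of the formula -/

section PartitionSums

variable {α : Type*} [DecidableEq α]

/-- The product `(2|π₁| - 3)!! ⋯ (2|πₖ| - 3)!!`. -/
def blockWeight (X : Finset (Finset α)) : ℕ := ∏ B ∈ X, (2 * B.card - 3)‼

/-- The number of nonsingletons in a family of sets. -/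
def numNonsingletons (X : Finset (Finset α)) : ℕ := (X.filter fun B => B.card ≠ 1).card

/-- At `m = 1` the truncated `2 * 1 - 3` gives `0‼ = 1`, which is the right value for $(-1)!!$. At
`m = 0` the identity would fail. -/
theorem doubleFactorial_insert {m : ℕ} (hm : 1 ≤ m) :
    (2 * (m + 1) - 3)‼ = (2 * m - 1) * (2 * m - 3)‼ := by
  obtain rfl | hm := hm.eq_or_lt
  · rfl
  · obtain ⟨j, rfl⟩ := Nat.exists_eq_add_of_lt hm
    rw [show 2 * (1 + j + 1 + 1) - 3 = 2 * j + 1 + 2 by lia, Nat.doubleFactorial_add_two,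
      show 2 * (1 + j + 1) - 1 = 2 * j + 1 + 2 by lia, show 2 * (1 + j + 1) - 3 = 2 * j + 1 by lia]

variable {s : Finset α} {a : α} (P : Finpartition s)

theorem singleton_notMem_parts (ha : a ∉ s) : {a} ∉ P.parts := fun h =>
  ha (P.subset h (Finset.mem_singleton_self a))

theorem insert_notMem_parts_erase (ha : a ∉ s) (B : Finset α) : insert a B ∉ P.parts.erase B :=
  fun h => ha (P.subset (Finset.mem_erase.1 h).2 (Finset.mem_insert_self a B))

theorem blockWeight_insert_singleton (ha : a ∉ s) :
    blockWeight (insert {a} P.parts) = blockWeight P.parts := by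
  rw [blockWeight, Finset.prod_insert (singleton_notMem_parts P ha)]
  simp [blockWeight]

theorem numNonsingletons_insert_singleton :
    numNonsingletons (insert {a} P.parts) = numNonsingletons P.parts := by
  simp [numNonsingletons, Finset.filter_insert]

theorem card_insert_notMem (ha : a ∉ s) {B : Finset α} (hB : B ∈ P.parts) :
    (insert a B).card = B.card + 1 :=
  Finset.card_insert_of_notMem fun h => ha (P.subset hB h)

theorem blockWeight_insertInto (ha : a ∉ s) {B : Finset α} (hB : B ∈ P.parts) :
    blockWeight (insert (insert a B) (P.parts.erase B)) =
      (2 * B.card - 1) * blockWeight P.parts := by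
  rw [blockWeight, Finset.prod_insert (insert_notMem_parts_erase P ha B),
    card_insert_notMem P ha hB,
    doubleFactorial_insert (Finset.card_pos.2 (P.nonempty_of_mem_parts hB)), mul_assoc,
    Finset.mul_prod_erase _ (fun B => (2 * B.card - 3)‼) hB]
  rfl

theorem numNonsingletons_insertInto (ha : a ∉ s) {B : Finset α} (hB : B ∈ P.parts) :
    numNonsingletons (insert (insert a B) (P.parts.erase B)) =
      numNonsingletons P.parts + if B.card = 1 then 1 else 0 := by
  have hpos := Finset.card_pos.2 (P.nonempty_of_mem_parts hB)
  rw [numNonsingletons, Finset.filter_insert, if_pos (by rw [card_insert_notMem P ha hB]; lia),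
    Finset.card_insert_of_notMem fun h =>
      insert_notMem_parts_erase P ha B (Finset.mem_of_mem_filter _ h), Finset.filter_erase,
    numNonsingletons]
  split_ifs with h
  · rw [Finset.erase_eq_of_notMem (by simp [h])]
  · rw [Finset.card_erase_add_one (by simp [h, hB])]
    rfl

/-- The total factor gained by joining the new element to an old block is $2|s|-k$; the form avoids
subtraction. -/
theorem sum_two_mul_card_sub_one :
    ∑ B ∈ P.parts, (2 * B.card - 1) + P.parts.card = 2 * s.card := by
  rw [← P.sum_card_parts, Finset.mul_sum, Finset.card_eq_sum_ones, ← Finset.sum_add_distrib]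
  refine Finset.sum_congr rfl fun B hB => ?_
  have := Finset.card_pos.2 (P.nonempty_of_mem_parts hB)
  lia

/-- The coefficient `2 * B.card - 1` is `1` on singletons, so the sum just counts them. -/
theorem sum_singletons :
    ∑ B ∈ P.parts, (2 * B.card - 1) * (if B.card = 1 then 1 else 0) + numNonsingletons P.parts =
      P.parts.card := by
  rw [numNonsingletons, Finset.card_filter, ← Finset.sum_add_distrib, Finset.card_eq_sum_ones]
  refine Finset.sum_congr rfl fun B _ => ?_
  by_cases h : B.card = 1 <;> simp [h]

/-- Both weights needed below depend only on the numbers of blocks and of nonsingletons, so one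
insertion formula serves for both. -/
theorem sum_weight_insert (ha : a ∉ s) (w : ℕ → ℕ → ℕ) :
    ∑ Q : Finpartition (insert a s),
        w Q.parts.card (numNonsingletons Q.parts) * blockWeight Q.parts =
      ∑ P : Finpartition s, (w (P.parts.card + 1) (numNonsingletons P.parts) +
        ∑ B ∈ P.parts, (2 * B.card - 1) * w P.parts.card
          (numNonsingletons P.parts + if B.card = 1 then 1 else 0)) * blockWeight P.parts := by
  rw [Finpartition.sum_parts_insert ha
    fun X => w X.card (numNonsingletons X) * blockWeight X]
  refine Finset.sum_congr rfl fun P _ => ?_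
  rw [add_mul, Finset.sum_mul]
  congr 1
  · rw [blockWeight_insert_singleton P ha, numNonsingletons_insert_singleton,
      Finset.card_insert_of_notMem (singleton_notMem_parts P ha)]
  · refine Finset.sum_congr rfl fun B hB => ?_
    rw [blockWeight_insertInto P ha hB, numNonsingletons_insertInto P ha hB,
      Finset.card_insert_of_notMem (insert_notMem_parts_erase P ha B),
      Finset.card_erase_add_one hB]
    ring

/-- Over a partition with $k$ blocks the factor of $k!$ is $(k+1)+(2|s|-k)$, independent of the
partition. -/
theorem sum_factorial_mul_blockWeight_insert (ha : a ∉ s) :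
    ∑ Q : Finpartition (insert a s), Q.parts.card ! * blockWeight Q.parts =
      (2 * s.card + 1) * ∑ P : Finpartition s, P.parts.card ! * blockWeight P.parts := by
  rw [sum_weight_insert ha fun k _ => k !, Finset.mul_sum]
  refine Finset.sum_congr rfl fun P _ => ?_
  rw [← Finset.sum_mul, ← sum_two_mul_card_sub_one P, Nat.factorial_succ]
  ring

/-- Over a partition with $k$ blocks, $t$ of them nonsingleton, the factor of $(k-1)!$ is
$tk+t(2|s|-k)+(k-t)=(2|s|-1)t+k$. Nonemptiness gives $k\ge 1$, hence $k\,(k-1)!=k!$. -/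
theorem sum_linearDWeight_insert (ha : a ∉ s) (hs : s.Nonempty) :
    ∑ Q : Finpartition (insert a s),
        numNonsingletons Q.parts * (Q.parts.card - 1)! * blockWeight Q.parts =
      (2 * s.card - 1) * ∑ P : Finpartition s,
          numNonsingletons P.parts * (P.parts.card - 1)! * blockWeight P.parts +
        ∑ P : Finpartition s, P.parts.card ! * blockWeight P.parts := by
  rw [sum_weight_insert ha fun k t => t * (k - 1)!, Finset.mul_sum, ← Finset.sum_add_distrib]
  refine Finset.sum_congr rfl fun P _ => ?_
  obtain ⟨k, hk⟩ : ∃ k, P.parts.card = k + 1 := Nat.exists_eq_succ_of_ne_zero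
    (Finset.card_pos.2 (P.parts_nonempty hs.ne_empty)).ne'
  have h1 := sum_two_mul_card_sub_one P
  have h2 := sum_singletons P
  obtain ⟨c, hc⟩ : ∃ c, s.card = c + 1 :=
    Nat.exists_eq_succ_of_ne_zero (Finset.card_pos.2 hs).ne'
  simp only [← mul_assoc, mul_add, add_mul, Finset.sum_add_distrib, ← Finset.sum_mul]
  rw [hk] at h1 h2 ⊢
  rw [hc] at h1 ⊢
  rw [show 2 * (c + 1) = 2 * c + 2 by ring] at h1 ⊢
  simp only [add_tsub_cancel_right, Nat.factorial_succ, show 2 * c + 2 - 1 = 2 * c + 1 by lia]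
  set t := numNonsingletons P.parts
  set A := ∑ B ∈ P.parts, (2 * B.card - 1)
  set D := ∑ B ∈ P.parts, (2 * B.card - 1) * (if B.card = 1 then 1 else 0)
  -- With `k + 1` blocks and `c + 1` elements, this compares the coefficients of `k ! * blockWeight
  -- P.parts`.
  have h3 : (k + 1) * t + A * t + D = (2 * c + 1) * t + (k + 1) := by
    linear_combination t * h1 + h2
  linear_combination (k ! * blockWeight P.parts) * h3

theorem sum_factorial_mul_blockWeight (s : Finset α) :
    ∑ P : Finpartition s, P.parts.card ! * blockWeight P.parts = (2 * s.card - 1)‼ := by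
  induction s using Finset.induction_on with
  | empty =>
    change ∑ P : Finpartition (⊥ : Finset α), _ = _
    rw [Fintype.sum_unique]
    rfl
  | insert a s ha ih =>
    rw [sum_factorial_mul_blockWeight_insert ha, ih, Finset.card_insert_of_notMem ha]
    rcases s.card with _ | m
    · rfl
    · rw [show 2 * (m + 1 + 1) - 1 = 2 * m + 1 + 2 by lia, Nat.doubleFactorial_add_two]
      congr 1

theorem sum_linearDWeight (s : Finset α) :
    ∑ P : Finpartition s, numNonsingletons P.parts * (P.parts.card - 1)! * blockWeight P.parts =
      (2 * s.card - 3)‼ * (s.card - 1) := by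
  induction s using Finset.induction_on with
  | empty =>
    change ∑ P : Finpartition (⊥ : Finset α), _ = _
    rw [Fintype.sum_unique]
    rfl
  | insert a s ha ih =>
    -- The recursion starts at a nonempty `s`, so the one-element set is treated directly.
    obtain rfl | hs := s.eq_empty_or_nonempty
    · rw [sum_weight_insert ha fun k t => t * (k - 1)!]
      change ∑ P : Finpartition (⊥ : Finset α), _ = _
      rw [Fintype.sum_unique]
      have h : (default : Finpartition (⊥ : Finset α)).parts = ∅ := rfl
      simp [numNonsingletons, h]
    · rw [sum_linearDWeight_insert ha hs, sum_factorial_mul_blockWeight, ih,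
        Finset.card_insert_of_notMem ha]
      rcases h : s.card with _ | _ | m
      · simp [hs.ne_empty] at h
      · rfl
      · rw [show 2 * (m + 1 + 1 + 1) - 3 = 2 * m + 1 + 2 by lia,
          show 2 * (m + 1 + 1) - 3 = 2 * m + 1 by lia,
          show 2 * (m + 1 + 1) - 1 = 2 * m + 1 + 2 by lia, Nat.doubleFactorial_add_two]
        simp only [add_tsub_cancel_right]
        ring

end PartitionSums

theorem chainFormula_linearDWeight (n : ℕ) :
    chainFormula n linearDWeight = (2 * n - 3)‼ * (n - 1) := by
  have h := sum_linearDWeight (Finset.univ : Finset (Fin n))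
  rwa [Finset.card_univ, Fintype.card_fin] at h

/-! ## Counting increasing ordered trees -/

/-! ### Inserting an entry into a list -/

theorem List.insertIdx_eq_take_append_cons_drop {α : Type*} (x : α) :
    ∀ (l : List α) (k : ℕ), k ≤ l.length → l.insertIdx k x = l.take k ++ x :: l.drop k
  | _, 0, _ => by simp
  | [], k + 1, h => by simp at h
  | a :: l, k + 1, h => by
    rw [List.insertIdx_succ_cons,
      List.insertIdx_eq_take_append_cons_drop x l k (by simpa using h)]
    simp

/-- The new entry marks its position: if `j < k`, the entry at `j` is `x` on one side and an old
entry on the other. -/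
theorem List.insertIdx_index_injective {α : Type*} {x : α} {l : List α} (hx : x ∉ l) {j k : ℕ}
    (hj : j ≤ l.length) (hk : k ≤ l.length) (h : l.insertIdx j x = l.insertIdx k x) : j = k := by
  have key : ∀ {j k : ℕ}, k ≤ l.length → l.insertIdx j x = l.insertIdx k x → j ≤ l.length →
      ¬ j < k := by
    intro j k hk h hj hlt
    have h1 := congrArg (·[j]?) h
    simp only [List.getElem?_insertIdx_self, if_pos hj, List.getElem?_insertIdx_of_lt hlt] at h1
    exact hx (List.mem_of_getElem? h1.symm)
  exact le_antisymm (not_lt.1 (key hj h.symm hk)) (not_lt.1 (key hk h hj))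

theorem List.exists_map_castSucc {n : ℕ} {l : List (Fin (n + 1))} (h : Fin.last n ∉ l) :
    ∃ l' : List (Fin n), l'.map Fin.castSucc = l := by
  induction l with
  | nil => exact ⟨[], rfl⟩
  | cons a l ih =>
    rw [List.mem_cons, not_or] at h
    obtain ⟨l', rfl⟩ := ih h.2
    obtain ⟨b, rfl⟩ := Fin.exists_castSucc_eq.2 (Ne.symm h.1)
    exact ⟨b :: l', rfl⟩

theorem Fin.last_notMem_map_castSucc {n : ℕ} (l : List (Fin n)) :
    Fin.last n ∉ l.map Fin.castSucc := by
  rw [List.mem_map]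
  rintro ⟨a, -, ha⟩
  exact Fin.castSucc_ne_last a ha

/-! ### Growing a tree by a new largest node -/

namespace IncreasingOrderedTree

variable {n : ℕ}

/-- The lists of children after the node `n + 1` has been added as the `k`-th child of `v`. -/
def insertChildren (c : Fin (n + 1) → List (Fin (n + 1))) (v : Fin (n + 1)) (k : ℕ) :
    Fin (n + 2) → List (Fin (n + 2)) :=
  Fin.lastCases [] fun u => if u = v then ((c u).map Fin.castSucc).insertIdx k (Fin.last (n + 1))
    else (c u).map Fin.castSucc

@[simp]
theorem insertChildren_last (c : Fin (n + 1) → List (Fin (n + 1))) (v : Fin (n + 1)) (k : ℕ) :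
    insertChildren c v k (Fin.last (n + 1)) = [] := Fin.lastCases_last

theorem insertChildren_castSucc (c : Fin (n + 1) → List (Fin (n + 1))) (v : Fin (n + 1)) (k : ℕ)
    (u : Fin (n + 1)) : insertChildren c v k u.castSucc =
      if u = v then ((c u).map Fin.castSucc).insertIdx k (Fin.last (n + 1))
        else (c u).map Fin.castSucc :=
  Fin.lastCases_castSucc ..

theorem last_mem_insertChildren {c : Fin (n + 1) → List (Fin (n + 1))} {v : Fin (n + 1)} {k : ℕ}
    (hk : k ≤ (c v).length) {u : Fin (n + 2)} :
    Fin.last (n + 1) ∈ insertChildren c v k u ↔ u = v.castSucc := by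
  induction u using Fin.lastCases with
  | last => simp [(Fin.castSucc_ne_last v).symm]
  | cast u =>
    rw [insertChildren_castSucc, Fin.castSucc_inj]
    split_ifs with h
    · subst h
      simp [List.mem_insertIdx (show k ≤ ((c u).map Fin.castSucc).length by simpa using hk)]
    · simp [h, Fin.last_notMem_map_castSucc, -List.mem_map]

theorem castSucc_mem_insertChildren {c : Fin (n + 1) → List (Fin (n + 1))} {v : Fin (n + 1)}
    {k : ℕ} (hk : k ≤ (c v).length) {u w : Fin (n + 1)} :
    w.castSucc ∈ insertChildren c v k u.castSucc ↔ w ∈ c u := by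
  have hmap : w.castSucc ∈ (c u).map Fin.castSucc ↔ w ∈ c u :=
    List.mem_map_of_injective (Fin.castSucc_injective _)
  rw [insertChildren_castSucc]
  split_ifs with h
  · subst h
    rw [List.mem_insertIdx (by simpa using hk), hmap]
    simp [Fin.castSucc_ne_last]
  · exact hmap

/-- Add the node `n + 1` as the `k`-th child of `v`. -/
def insertLast (T : IncreasingOrderedTree n) (v : Fin (n + 1)) (k : ℕ)
    (hk : k ≤ (T.children v).length) : IncreasingOrderedTree (n + 1) where
  children := insertChildren T.children v k
  nodup u := by
    induction u using Fin.lastCases with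
    | last => simp
    | cast u =>
      have h : ((T.children u).map Fin.castSucc).Nodup :=
        (T.nodup u).map (Fin.castSucc_injective _)
      rw [insertChildren_castSucc]
      split_ifs with huv
      · subst huv
        rw [(List.perm_insertIdx _ _ (by simpa using hk)).nodup_iff, List.nodup_cons]
        exact ⟨Fin.last_notMem_map_castSucc _, h⟩
      · exact h
  lt_of_mem u w hw := by
    induction u using Fin.lastCases with
    | last => simp at hw
    | cast u =>
      induction w using Fin.lastCases with
      | last => exact Fin.castSucc_lt_last u
      | cast w =>
        exact Fin.castSucc_lt_castSucc_iff.2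
          (T.lt_of_mem u w ((castSucc_mem_insertChildren hk).1 hw))
  existsUnique_parent w hw := by
    induction w using Fin.lastCases with
    | last =>
      exact ⟨v.castSucc, (last_mem_insertChildren hk).2 rfl,
        fun u hu => (last_mem_insertChildren hk).1 hu⟩
    | cast w =>
      obtain ⟨u, hu, huniq⟩ := T.existsUnique_parent w (by rintro rfl; exact hw rfl)
      refine ⟨u.castSucc, (castSucc_mem_insertChildren hk).2 hu, fun u' hu' => ?_⟩
      induction u' using Fin.lastCases with
      | last => simp at hu'
      | cast u' => rw [huniq u' ((castSucc_mem_insertChildren hk).1 hu')]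

/-- The positions at which a new node can be added to a tree. -/
abbrev Position (T : IncreasingOrderedTree n) : Type :=
  Σ v : Fin (n + 1), Fin ((T.children v).length + 1)

/-- Add the node `n + 1` at a given position. -/
def insertAt (p : Σ T : IncreasingOrderedTree n, T.Position) : IncreasingOrderedTree (n + 1) :=
  p.1.insertLast p.2.1 p.2.2 (Nat.le_of_lt_succ p.2.2.2)

/-- The largest node reveals its parent and its place there, and filtering it out of every list
returns the old tree. -/
theorem insertAt_injective : Function.Injective (insertAt (n := n)) := by
  rintro ⟨T, v, k, hk⟩ ⟨T', v', k', hk'⟩ h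
  have hk₁ := Nat.le_of_lt_succ hk
  have hk₁' := Nat.le_of_lt_succ hk'
  have hc : insertChildren T.children v k = insertChildren T'.children v' k' :=
    congrArg children h
  obtain rfl : v = v' := by
    have h1 := (last_mem_insertChildren hk₁).2 rfl
    rw [hc] at h1
    exact Fin.castSucc_injective _ ((last_mem_insertChildren hk₁').1 h1)
  have hfilter : ∀ (c : Fin (n + 1) → List (Fin (n + 1))) (k : ℕ), k ≤ (c v).length → ∀ u,
      (insertChildren c v k u.castSucc).filter (· ≠ Fin.last (n + 1)) =
        (c u).map Fin.castSucc := by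
    intro c k hk u
    have hid : ((c u).map Fin.castSucc).filter (· ≠ Fin.last (n + 1)) =
        (c u).map Fin.castSucc :=
      List.filter_eq_self.2 fun w hw => by
        simpa using fun h : w = Fin.last (n + 1) => Fin.last_notMem_map_castSucc _ (h ▸ hw)
    rw [insertChildren_castSucc]
    split_ifs with huv
    · subst huv
      rw [List.insertIdx_eq_take_append_cons_drop _ _ _ (by simpa using hk), List.filter_append,
        List.filter_cons_of_neg (by simp), ← List.filter_append, List.take_append_drop, hid]
    · exact hid
  obtain rfl : T = T' := by
    ext1
    funext u
    apply List.map_injective_iff.2 (Fin.castSucc_injective (n + 1))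
    rw [← hfilter T.children k hk₁ u, ← hfilter T'.children k' hk₁' u, hc]
  have h2 := congrFun hc v.castSucc
  rw [insertChildren_castSucc, insertChildren_castSucc, if_pos rfl, if_pos rfl] at h2
  obtain rfl := List.insertIdx_index_injective (Fin.last_notMem_map_castSucc _)
    (by simpa using hk₁) (by simpa using hk₁') h2
  rfl

/-- The largest node is a leaf, so it can be deleted; its place is where it cuts the list of its
parent. -/
theorem insertAt_surjective : Function.Surjective (insertAt (n := n)) := by
  intro T
  obtain ⟨v, hv, hvuniq⟩ := T.existsUnique_parent (Fin.last (n + 1)) (Fin.last_pos.ne')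
  obtain ⟨v, rfl⟩ := Fin.exists_castSucc_eq.2 (T.lt_of_mem v _ hv).ne
  obtain ⟨l₁, l₂, hl⟩ := List.append_of_mem hv
  have hnodup := T.nodup v.castSucc
  rw [hl, List.nodup_middle, List.nodup_cons, List.mem_append, not_or] at hnodup
  obtain ⟨m₁, rfl⟩ := List.exists_map_castSucc hnodup.1.1
  obtain ⟨m₂, rfl⟩ := List.exists_map_castSucc hnodup.1.2
  -- By uniqueness of the parent, the lists of the other nodes avoid the largest node; the value
  -- chosen at `v` is irrelevant.
  have hex : ∀ u, ∃ l : List (Fin (n + 1)), u ≠ v → l.map Fin.castSucc = T.children u.castSucc := by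
    intro u
    by_cases h : u = v
    · exact ⟨[], fun h' => absurd h h'⟩
    · obtain ⟨l, hl⟩ := List.exists_map_castSucc
        (l := T.children u.castSucc) fun hm => h (Fin.castSucc_injective _ (hvuniq _ hm))
      exact ⟨l, fun _ => hl⟩
  choose c₀ hc₀ using hex
  set c : Fin (n + 1) → List (Fin (n + 1)) := fun u => if u = v then m₁ ++ m₂ else c₀ u with hc
  have hk : m₁.length ≤ (c v).length := by simp [hc]
  have key : insertChildren c v m₁.length = T.children := by
    funext u
    induction u using Fin.lastCases with
    | last =>
      rw [insertChildren_last, eq_comm, List.eq_nil_iff_forall_not_mem]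
      exact fun w hw => (T.lt_of_mem _ w hw).not_ge (Fin.le_last w)
    | cast u =>
      rw [insertChildren_castSucc]
      split_ifs with h
      · subst h
        rw [hl, List.insertIdx_eq_take_append_cons_drop _ _ _ (by simpa using hk)]
        simp [hc]
      · simp only [hc, if_neg h]
        exact hc₀ u h
  have hmem : ∀ u w, w ∈ c u ↔ w.castSucc ∈ T.children u.castSucc := fun u w => by
    rw [← key, castSucc_mem_insertChildren hk]
  refine ⟨⟨⟨c, fun u => ?_, fun u w hw => ?_, fun w hw => ?_⟩, v, m₁.length,
    Nat.lt_succ_of_le hk⟩, IncreasingOrderedTree.ext key⟩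
  · by_cases h : u = v
    · subst h
      have := hnodup.2
      rw [← List.map_append] at this
      simpa [hc] using this.of_map
    · simp only [hc, if_neg h]
      have := T.nodup u.castSucc
      rw [← hc₀ u h] at this
      exact this.of_map
  · exact Fin.castSucc_lt_castSucc_iff.1 (T.lt_of_mem _ _ ((hmem u w).1 hw))
  · obtain ⟨u, hu, huniq⟩ := T.existsUnique_parent w.castSucc fun h =>
      hw (Fin.castSucc_injective _ h)
    obtain ⟨u, rfl⟩ := Fin.exists_castSucc_eq.2
      ((T.lt_of_mem u _ hu).trans_le (Fin.le_last _)).ne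
    exact ⟨u, (hmem u w).2 hu, fun u' hu' =>
      Fin.castSucc_injective _ (huniq _ ((hmem u' w).1 hu'))⟩

theorem insertAt_bijective : Function.Bijective (insertAt (n := n)) :=
  ⟨insertAt_injective, insertAt_surjective⟩

instance instUniqueZero : Unique (IncreasingOrderedTree 0) where
  default := ⟨fun _ => [], by simp, by simp, fun w hw => absurd (Fin.eq_zero w) hw⟩
  uniq T := by
    ext1
    funext v
    rw [List.eq_nil_iff_forall_not_mem]
    exact fun w hw => (T.lt_of_mem v w hw).ne ((Fin.eq_zero v).trans (Fin.eq_zero w).symm)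

noncomputable instance instFintype : ∀ n, Fintype (IncreasingOrderedTree n)
  | 0 => inferInstance
  | n + 1 =>
    haveI := instFintype n
    Fintype.ofBijective _ (insertAt_bijective (n := n))

/-- A node with $d$ children offers $d+1$ places, and each of the $n$ nodes other than the root is a
child exactly once: $n+(n+1)$. -/
theorem card_position (T : IncreasingOrderedTree n) : Fintype.card T.Position = 2 * n + 1 := by
  have h : ∑ v, (T.children v).length = n := by
    have h1 : ∀ v, (T.children v).length = (T.children v).toFinset.card := fun v =>
      (List.toFinset_card_of_nodup (T.nodup v)).symm
    simp only [h1]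
    rw [← Finset.card_biUnion]
    · have : Finset.univ.biUnion (fun v => (T.children v).toFinset) = Finset.univ.erase 0 := by
        ext w
        simp only [Finset.mem_biUnion, Finset.mem_univ, true_and, List.mem_toFinset,
          Finset.mem_erase, and_true]
        exact ⟨fun ⟨v, hv⟩ => (Fin.zero_le v |>.trans_lt (T.lt_of_mem v w hv)).ne',
          fun hw => (T.existsUnique_parent w hw).exists⟩
      rw [this, Finset.card_erase_of_mem (Finset.mem_univ _), Finset.card_univ, Fintype.card_fin]
      rfl
    · intro u _ v _ huv
      refine Finset.disjoint_left.2 fun w hu hv => ?_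
      rw [List.mem_toFinset] at hu hv
      exact huv ((T.existsUnique_parent w
        (Fin.zero_le v |>.trans_lt (T.lt_of_mem v w hv)).ne').unique hu hv)
  rw [Fintype.card_sigma]
  simp only [Fintype.card_fin]
  rw [Finset.sum_add_distrib, h]
  simp
  lia

theorem card_eq (n : ℕ) : Fintype.card (IncreasingOrderedTree n) = (2 * n - 1)‼ := by
  induction n with
  | zero => rw [Fintype.card_unique]; rfl
  | succ n ih =>
    rw [← Fintype.card_of_bijective (insertAt_bijective (n := n)), Fintype.card_sigma]
    simp only [card_position, Finset.sum_const, Finset.card_univ, smul_eq_mul, ih]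
    rcases n with _ | n
    · rfl
    · rw [show 2 * (n + 1 + 1) - 1 = 2 * n + 1 + 2 by lia, Nat.doubleFactorial_add_two, mul_comm]
      rfl

/-! ### Counting 1-flourishing trees -/

theorem isFlourishing_one_iff {T : IncreasingOrderedTree n} {w : Fin (n + 1)}
    {l : List (Fin (n + 1))} (h : T.children 0 = w :: l) :
    T.IsFlourishing 1 ↔ T.children w ≠ [] := by
  simp [IsFlourishing, h]

/-- The parent of the node `1` is smaller than `1`, hence is the root. -/
theorem exists_children_zero_eq_cons (hn : 1 ≤ n) (T : IncreasingOrderedTree n) :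
    ∃ w l, T.children 0 = w :: l := by
  have : NeZero n := ⟨by lia⟩
  obtain ⟨v, hv, -⟩ := T.existsUnique_parent 1 Fin.one_pos'.ne'
  obtain rfl : v = 0 := by
    have h := T.lt_of_mem v 1 hv
    rw [Fin.lt_def, Fin.val_one', Nat.mod_eq_of_lt (by lia)] at h
    exact Fin.ext (by rw [Fin.val_zero]; lia)
  exact List.exists_cons_of_ne_nil (List.ne_nil_of_mem hv)

/-- In front of the children of the root the new leaf becomes the first child. Anywhere else `w`
remains the first child, and loses its leaf status only by receiving the new node. -/
theorem isFlourishing_insertLast {T : IncreasingOrderedTree n} {w : Fin (n + 1)}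
    {l : List (Fin (n + 1))} (h : T.children 0 = w :: l) (v : Fin (n + 1)) (k : ℕ)
    (hk : k ≤ (T.children v).length) :
    (T.insertLast v k hk).IsFlourishing 1 ↔
      ¬ (v = 0 ∧ k = 0) ∧ (T.children w ≠ [] ∨ v = w) := by
  have hw : w ≠ 0 := (T.lt_of_mem 0 w (by simp [h])).ne'
  have h0 : (T.insertLast v k hk).children 0 = insertChildren T.children v k (Fin.castSucc 0) := rfl
  have hc : (T.insertLast v k hk).children w.castSucc ≠ [] ↔ T.children w ≠ [] ∨ v = w := by
    change insertChildren T.children v k w.castSucc ≠ [] ↔ _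
    rw [insertChildren_castSucc]
    split_ifs with hwv
    · subst hwv
      simp [List.insertIdx_eq_take_append_cons_drop _ _ _
        (show k ≤ ((T.children w).map Fin.castSucc).length by simpa using hk)]
    · simp [Ne.symm hwv]
  rw [insertChildren_castSucc, h] at h0
  by_cases hv : v = 0
  · subst hv
    rcases k with _ | k
    · rw [if_pos rfl, List.insertIdx_zero] at h0
      rw [isFlourishing_one_iff h0]
      simp [insertLast]
    · rw [if_pos rfl, List.map_cons, List.insertIdx_succ_cons] at h0
      rw [isFlourishing_one_iff h0, hc]
      simp
  · rw [if_neg (Ne.symm hv), List.map_cons] at h0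
    rw [isFlourishing_one_iff h0, hc]
    simp [hv]

-- If `T` is flourishing, `2 * n` of the `2 * n + 1` positions are good. Otherwise the first child
-- of the root is a leaf, and the one good position is below it.
open Classical in
theorem card_flourishing_positions (hn : 1 ≤ n) (T : IncreasingOrderedTree n) :
    (Finset.univ.filter fun p : T.Position => (insertAt ⟨T, p⟩).IsFlourishing 1).card =
      1 + if T.IsFlourishing 1 then 2 * n - 1 else 0 := by
  obtain ⟨w, l, h⟩ := exists_children_zero_eq_cons hn T
  have hw : w ≠ 0 := (T.lt_of_mem 0 w (by simp [h])).ne'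
  have hins : ∀ p : T.Position, (insertAt ⟨T, p⟩).IsFlourishing 1 ↔
      p ≠ ⟨0, 0⟩ ∧ (T.children w ≠ [] ∨ p.1 = w) := by
    rintro ⟨v, k⟩
    refine (isFlourishing_insertLast h v k (Nat.le_of_lt_succ k.2)).trans
      (and_congr_left' (not_congr ?_))
    constructor
    · rintro ⟨rfl, hk⟩
      rw [show k = 0 from Fin.ext (by simpa using hk)]
    · rintro ⟨⟩
      exact ⟨rfl, rfl⟩
  simp only [hins, isFlourishing_one_iff h]
  split_ifs with hT
  · simp only [hT, ne_eq, not_false_eq_true, true_or, and_true]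
    rw [Finset.filter_ne' Finset.univ, Finset.card_erase_of_mem (Finset.mem_univ _),
      Finset.card_univ, card_position]
    lia
  · rw [not_not] at hT
    rw [add_zero, Finset.card_eq_one]
    refine ⟨⟨w, 0⟩, ?_⟩
    ext ⟨v, k⟩
    simp only [hT, Finset.mem_filter, Finset.mem_univ, true_and, Finset.mem_singleton, ne_eq,
      not_true_eq_false, false_or]
    constructor
    · rintro ⟨-, rfl⟩
      have hk : (k : ℕ) = 0 := by simpa [hT] using k.2
      rw [show k = 0 from Fin.ext (by simpa using hk)]
    · rintro ⟨⟩
      exact ⟨fun h' => hw (congrArg Sigma.fst h'), rfl⟩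

-- Summing over the `(2 * n - 1)‼` trees gives the recursion of `sum_linearDWeight_insert`.
open Classical in
theorem card_flourishing (n : ℕ) :
    (Finset.univ.filter fun T : IncreasingOrderedTree n => T.IsFlourishing 1).card =
      (2 * n - 3)‼ * (n - 1) := by
  induction n with
  | zero =>
    rw [zero_tsub, mul_zero, Finset.card_eq_zero, Finset.filter_eq_empty_iff]
    intro T _ hT
    rw [Unique.eq_default T] at hT
    exact absurd hT.1 (by simp [default])
  | succ n ih =>
    obtain rfl | hn := n.eq_zero_or_pos
    · simp only [zero_add, tsub_self, mul_zero, Finset.card_eq_zero, Finset.filter_eq_empty_iff]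
      intro T _ hT
      obtain ⟨w, l, h⟩ := exists_children_zero_eq_cons le_rfl T
      rw [isFlourishing_one_iff h] at hT
      obtain ⟨u, hu⟩ := List.exists_mem_of_ne_nil _ hT
      have h1 := T.lt_of_mem 0 w (by simp [h])
      have h2 := T.lt_of_mem w u hu
      lia
    · rw [Finset.card_filter, ← Fintype.sum_bijective _ (insertAt_bijective (n := n))
        (fun p => if (insertAt p).IsFlourishing 1 then 1 else 0) _ fun _ => rfl,
        Fintype.sum_sigma]
      simp only [← Finset.card_filter, card_flourishing_positions hn]
      rw [Finset.sum_add_distrib, ← Finset.card_eq_sum_ones, Finset.card_univ, card_eq,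
        ← Finset.sum_filter, Finset.sum_const, ih, smul_eq_mul]
      obtain rfl | hn' := (Nat.succ_le_of_lt hn).eq_or_lt
      · rfl
      · obtain ⟨m, rfl⟩ := Nat.exists_eq_add_of_lt (show 1 < n from hn')
        rw [show 2 * (1 + m + 1 + 1) - 3 = 2 * m + 1 + 2 by lia,
          show 2 * (1 + m + 1) - 3 = 2 * m + 1 by lia,
          show 2 * (1 + m + 1) - 1 = 2 * m + 1 + 2 by lia, Nat.doubleFactorial_add_two,
          show 1 + m + 1 + 1 - 1 = m + 2 by lia, show 1 + m + 1 - 1 = m + 1 by lia]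
        ring

theorem encard_flourishing (n : ℕ) :
    {T : IncreasingOrderedTree n | T.IsFlourishing 1}.encard =
      ((2 * n - 3)‼ * (n - 1) : ℕ) := by
  classical
  rw [← card_flourishing, ← Set.encard_coe_eq_coe_finsetCard]
  simp

end IncreasingOrderedTree

/-! ## Labeled partitions with a single sign -/

section Bar

variable {n : ℕ}

@[simp]
theorem barElt_barElt (a : BarSet n) : barElt (barElt a) = a := by simp [barElt]

theorem barElt_injective : Function.Injective (barElt (n := n)) :=
  Function.Involutive.injective barElt_barElt

@[simp]
theorem mem_barImage {X : Finset (BarSet n)} {a : BarSet n} : a ∈ barImage X ↔ barElt a ∈ X := by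
  rw [barImage, Finset.mem_image]
  constructor
  · rintro ⟨b, hb, rfl⟩
    rwa [barElt_barElt]
  · exact fun h => ⟨_, h, barElt_barElt a⟩

@[simp]
theorem barImage_barImage (X : Finset (BarSet n)) : barImage (barImage X) = X := by
  ext a
  simp

theorem barImage_eq_iff {X Y : Finset (BarSet n)} : barImage X = Y ↔ X = barImage Y := by
  constructor
  · rintro rfl
    simp
  · rintro rfl
    simp

theorem barImage_inj {X Y : Finset (BarSet n)} : barImage X = barImage Y ↔ X = Y := by
  rw [barImage_eq_iff, barImage_barImage]

theorem barImage_union (X Y : Finset (BarSet n)) :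
    barImage (X ∪ Y) = barImage X ∪ barImage Y := by
  ext a
  simp

@[simp]
theorem barImage_empty : barImage (∅ : Finset (BarSet n)) = ∅ := rfl

theorem barImage_mono {X Y : Finset (BarSet n)} (h : X ⊆ Y) : barImage X ⊆ barImage Y :=
  Finset.image_subset_image h

theorem barImage_subset_iff {X Y : Finset (BarSet n)} : barImage X ⊆ Y ↔ X ⊆ barImage Y :=
  ⟨fun h => by simpa using barImage_mono h, fun h => by simpa using barImage_mono h⟩

theorem disjoint_barImage_iff {X Y : Finset (BarSet n)} :
    Disjoint (barImage X) Y ↔ Disjoint X (barImage Y) := by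
  simp only [Finset.disjoint_left, mem_barImage]
  exact ⟨fun h a ha ha' => h (by simpa using ha) ha', fun h a ha ha' => h ha (by simpa using ha')⟩

theorem card_barImage (X : Finset (BarSet n)) : (barImage X).card = X.card :=
  Finset.card_image_of_injective _ barElt_injective

theorem barImage_nonempty {X : Finset (BarSet n)} (h : X.Nonempty) : (barImage X).Nonempty :=
  h.image _

end Bar

namespace LabeledPartition

variable {n : ℕ} {S : Type*}

theorem exists_block (x : LabeledPartition n S) (a : BarSet n) : ∃ B ∈ x.blocks, a ∈ B :=
  x.toPartition.exists_mem (Finset.mem_univ a)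

theorem eq_of_mem_blocks {x : LabeledPartition n S} {B C : Finset (BarSet n)} (hB : B ∈ x.blocks)
    (hC : C ∈ x.blocks) {a : BarSet n} (haB : a ∈ B) (haC : a ∈ C) : B = C :=
  x.toPartition.eq_of_mem_parts hB hC haB haC

theorem nonempty_of_mem_blocks {x : LabeledPartition n S} {B : Finset (BarSet n)}
    (hB : B ∈ x.blocks) : B.Nonempty :=
  x.toPartition.nonempty_of_mem_parts hB

theorem barImage_mem_blocks {x : LabeledPartition n S} {B : Finset (BarSet n)}
    (hB : B ∈ x.blocks) : barImage B ∈ x.blocks :=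
  x.bar_mem B hB

theorem eq_of_subset_blocks {x : LabeledPartition n S} {B C : Finset (BarSet n)}
    (hB : B ∈ x.blocks) (hC : C ∈ x.blocks) (h : B ⊆ C) : B = C := by
  obtain ⟨a, ha⟩ := nonempty_of_mem_blocks hB
  exact eq_of_mem_blocks hB hC ha (h ha)

theorem disjoint_of_ne {x : LabeledPartition n S} {B C : Finset (BarSet n)}
    (hB : B ∈ x.blocks) (hC : C ∈ x.blocks) (h : B ≠ C) : Disjoint B C :=
  Finset.disjoint_left.2 fun _ h1 h2 => h (eq_of_mem_blocks hB hC h1 h2)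

theorem eq_or_eq_of_subset_union {x : LabeledPartition n S} {A B C : Finset (BarSet n)}
    (hA : A ∈ x.blocks) (hB : B ∈ x.blocks) (hC : C ∈ x.blocks) (h : C ⊆ A ∪ B) :
    C = A ∨ C = B := by
  obtain ⟨a, ha⟩ := nonempty_of_mem_blocks hC
  exact (Finset.mem_union.1 (h ha)).imp (eq_of_mem_blocks hC hA ha) (eq_of_mem_blocks hC hB ha)

theorem union_notMem_blocks {x : LabeledPartition n S} {A B : Finset (BarSet n)}
    (hA : A ∈ x.blocks) (hB : B ∈ x.blocks) (hAB : A ≠ B) : A ∪ B ∉ x.blocks := fun h =>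
  hAB ((eq_of_subset_blocks hA h Finset.subset_union_left).trans
    (eq_of_subset_blocks hB h Finset.subset_union_right).symm)

theorem union_eq_union {x : LabeledPartition n S} {A B C D : Finset (BarSet n)}
    (hA : A ∈ x.blocks) (hB : B ∈ x.blocks) (hC : C ∈ x.blocks) (hD : D ∈ x.blocks)
    (hAB : A ≠ B) (h : A ∪ B = C ∪ D) : A = C ∧ B = D ∨ A = D ∧ B = C := by
  have h1 := eq_or_eq_of_subset_union hC hD hA (h ▸ Finset.subset_union_left)
  have h2 := eq_or_eq_of_subset_union hC hD hB (h ▸ Finset.subset_union_right)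
  rcases h1 with rfl | rfl <;> rcases h2 with rfl | rfl
  · exact absurd rfl hAB
  · exact Or.inl ⟨rfl, rfl⟩
  · exact Or.inr ⟨rfl, rfl⟩
  · exact absurd rfl hAB

/-- Lets invariance under the involution replace signs in what follows. -/
theorem sign_eq_none_iff {x : LabeledPartition n S} {B : Finset (BarSet n)} (hB : B ∈ x.blocks) :
    x.sign B = none ↔ barImage B ≠ B := by
  rw [Ne, x.bar_eq_iff B hB, ← Option.isSome_iff_exists, Option.not_isSome_iff_eq_none]

theorem isUnsignedBlock_iff {x : LabeledPartition n S} {B : Finset (BarSet n)} :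
    x.IsUnsignedBlock B ↔ B ∈ x.blocks ∧ barImage B ≠ B :=
  and_congr_right fun hB => sign_eq_none_iff hB

theorem disjoint_barImage {x : LabeledPartition n S} {B : Finset (BarSet n)}
    (hB : B ∈ x.blocks) (h : barImage B ≠ B) : Disjoint B (barImage B) :=
  disjoint_of_ne hB (barImage_mem_blocks hB) h.symm

/-- The partition has a signed block. -/
def IsSigned (x : LabeledPartition n S) : Prop := ∃ B ∈ x.blocks, barImage B = B

theorem signs_eq_empty {x : LabeledPartition n S} (hx : ¬ x.IsSigned) : x.signs = ∅ := by
  rw [Set.eq_empty_iff_forall_notMem]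
  rintro σ ⟨B, hB⟩
  have hB' := mem_blocks_of_sign hB
  exact hx ⟨B, hB', (x.bar_eq_iff B hB').2 ⟨σ, hB⟩⟩

theorem signedBlock_eq_empty {x : LabeledPartition n S} (hx : ¬ x.IsSigned) (σ : S) :
    x.signedBlock σ = ∅ := by
  rw [Finset.eq_empty_iff_forall_notMem]
  intro a ha
  simp only [signedBlock, Finset.mem_biUnion, Finset.mem_filter] at ha
  obtain ⟨B, ⟨-, hB⟩, -⟩ := ha
  exact (Set.eq_empty_iff_forall_notMem.1 (signs_eq_empty hx)) σ ⟨B, hB⟩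

/-- The block of the element `v`. -/
noncomputable def block (x : LabeledPartition n S) (v : Fin n) : Finset (BarSet n) :=
  x.toPartition.part (v, false)

open Classical in
/-- The representatives of the normalized unsigned blocks. -/
noncomputable def leaders (x : LabeledPartition n S) : Finset (Fin n) :=
  Finset.univ.filter fun v => barImage (x.block v) ≠ x.block v ∧ ∀ a ∈ x.block v, v ≤ a.1

open Classical in
/-- The representatives of the normalized unsigned nonsingleton blocks. -/
noncomputable def bigLeaders (x : LabeledPartition n S) : Finset (Fin n) :=
  x.leaders.filter fun v => (x.block v).card ≠ 1

/-! ### Gluing blocks -/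

/-- The set `U` is a union of blocks of `x` which can be made a block of a coarser partition. -/
structure Gluable (x : LabeledPartition n S) (U : Finset (BarSet n)) : Prop where
  nonempty : U.Nonempty
  subset_or_disjoint : ∀ B ∈ x.blocks, B ⊆ U ∨ Disjoint B U
  bar : barImage U = U ∨ Disjoint U (barImage U)
  signed : barImage U = U → ∀ B ∈ x.blocks, barImage B = B → B ⊆ U

theorem Gluable.subset_or_disjoint_bar {x : LabeledPartition n S} {U : Finset (BarSet n)}
    (h : x.Gluable U) (B : Finset (BarSet n)) (hB : B ∈ x.blocks) :
    B ⊆ barImage U ∨ Disjoint B (barImage U) := by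
  rw [← barImage_subset_iff, ← disjoint_barImage_iff]
  exact h.subset_or_disjoint _ (barImage_mem_blocks hB)

open Classical in
/-- The blocks contained in `U` are replaced with `U`, and those in `Ū` with `Ū`. -/
noncomputable def glueParts (x : LabeledPartition n S) (U : Finset (BarSet n)) :
    Finset (Finset (BarSet n)) :=
  {U, barImage U} ∪ x.blocks.filter fun B => Disjoint B U ∧ Disjoint B (barImage U)

theorem mem_glueParts {x : LabeledPartition n S} {U B : Finset (BarSet n)} :
    B ∈ glueParts x U ↔
      B = U ∨ B = barImage U ∨ B ∈ x.blocks ∧ Disjoint B U ∧ Disjoint B (barImage U) := by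
  simp [glueParts]

theorem barImage_mem_glueParts {x : LabeledPartition n S} {U B : Finset (BarSet n)}
    (h : B ∈ glueParts x U) : barImage B ∈ glueParts x U := by
  rw [mem_glueParts] at h ⊢
  rcases h with rfl | rfl | ⟨h1, h2, h3⟩
  · exact Or.inr (Or.inl rfl)
  · exact Or.inl (barImage_barImage _)
  · refine Or.inr (Or.inr ⟨barImage_mem_blocks h1, disjoint_barImage_iff.2 h3, ?_⟩)
    rwa [disjoint_barImage_iff, barImage_barImage]

variable [Unique S]

theorem sign_of_barImage_eq {x : LabeledPartition n S} {B : Finset (BarSet n)}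
    (hB : B ∈ x.blocks) (h : barImage B = B) (σ : S) : x.sign B = some σ := by
  obtain ⟨τ, hτ⟩ := (x.bar_eq_iff B hB).1 h
  rw [hτ, Subsingleton.elim τ σ]

theorem signedBlock_of_barImage_eq {x : LabeledPartition n S} {B : Finset (BarSet n)}
    (hB : B ∈ x.blocks) (h : barImage B = B) (σ : S) : x.signedBlock σ = B :=
  signedBlock_eq (sign_of_barImage_eq hB h σ)

theorem eq_of_barImage_eq {x : LabeledPartition n S} {B C : Finset (BarSet n)}
    (hB : B ∈ x.blocks) (h : barImage B = B) (hC : C ∈ x.blocks) (h' : barImage C = C) :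
    B = C := by
  rw [← signedBlock_of_barImage_eq hB h default, signedBlock_of_barImage_eq hC h']

theorem IsSigned.signedBlock_mem {x : LabeledPartition n S} (hx : x.IsSigned) (σ : S) :
    x.signedBlock σ ∈ x.blocks := by
  obtain ⟨B, hB, h⟩ := hx
  rwa [signedBlock_of_barImage_eq hB h]

theorem barImage_signedBlock (x : LabeledPartition n S) (σ : S) :
    barImage (x.signedBlock σ) = x.signedBlock σ := by
  by_cases hx : x.IsSigned
  · obtain ⟨B, hB, h⟩ := hx
    rwa [signedBlock_of_barImage_eq hB h]
  · rw [signedBlock_eq_empty hx, barImage_empty]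

/-- A block containing an invariant block meets its own bar image, so it is invariant; with a single
sign the two signs then agree automatically. -/
theorem le_iff_blocks {x y : LabeledPartition n S} :
    x ≤ y ↔ ∀ B ∈ x.blocks, ∃ C ∈ y.blocks, B ⊆ C := by
  refine ⟨fun h B hB => h.exists_subset hB, fun h => ⟨?_, fun R hR => ?_⟩⟩
  · rintro σ ⟨B, hB⟩
    have hBx := mem_blocks_of_sign hB
    have hBB := (x.bar_eq_iff B hBx).2 ⟨σ, hB⟩
    obtain ⟨C, hC, hBC⟩ := h B hBx
    obtain ⟨a, ha⟩ := nonempty_of_mem_blocks hBx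
    have hCC : barImage C = C := by
      refine eq_of_mem_blocks (barImage_mem_blocks hC) hC (a := a) ?_ (hBC ha)
      rw [mem_barImage]
      apply hBC
      rwa [← mem_barImage, hBB]
    refine ⟨⟨C, sign_of_barImage_eq hC hCC σ⟩, ?_⟩
    rwa [signedBlock_eq hB, signedBlock_of_barImage_eq hC hCC]
  · obtain ⟨T, hT, hRT⟩ := h R hR.1
    exact ⟨T, hT, barImage_mem_blocks hT, hRT, barImage_mono hRT⟩

theorem exists_superset {x y : LabeledPartition n S} (h : x ≤ y) {B : Finset (BarSet n)}
    (hB : B ∈ x.blocks) : ∃ C ∈ y.blocks, B ⊆ C :=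
  le_iff_blocks.1 h B hB

theorem subset_of_le {x y : LabeledPartition n S} (h : x ≤ y) {B C : Finset (BarSet n)}
    (hB : B ∈ x.blocks) (hC : C ∈ y.blocks) {a : BarSet n} (haB : a ∈ B) (haC : a ∈ C) :
    B ⊆ C := by
  obtain ⟨D, hD, hBD⟩ := exists_superset h hB
  rwa [eq_of_mem_blocks hC hD haC (hBD haB)]

theorem isSigned_mono {x y : LabeledPartition n S} (h : x ≤ y) (hx : x.IsSigned) :
    y.IsSigned ∧ ∀ σ, x.signedBlock σ ⊆ y.signedBlock σ := by
  obtain ⟨B, hB, hBB⟩ := hx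
  have h1 := fun σ => h.1 σ ⟨B, sign_of_barImage_eq hB hBB σ⟩
  refine ⟨?_, fun σ => (h1 σ).2⟩
  by_contra hy
  have := (h1 default).1
  rw [signs_eq_empty hy] at this
  exact this

open Classical in
/-- The partition obtained from `x` by gluing the blocks contained in `U` and those in `Ū`. -/
noncomputable def glue (x : LabeledPartition n S) (U : Finset (BarSet n)) (h : x.Gluable U) :
    LabeledPartition n S where
  toPartition := Finpartition.ofExistsUnique (glueParts x U) (fun _ _ => Finset.subset_univ _)
    (by
      intro a _
      -- `U` and its bar image coincide as soon as they meet, so listing both does no harm.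
      have hbar : a ∈ U → a ∈ barImage U → U = barImage U := fun h1 h2 =>
        h.bar.elim Eq.symm fun h3 => absurd h2 (Finset.disjoint_left.1 h3 h1)
      by_cases haU : a ∈ U
      · refine ⟨U, ⟨mem_glueParts.2 (Or.inl rfl), haU⟩, fun B hB => ?_⟩
        rcases mem_glueParts.1 hB.1 with rfl | rfl | h1
        · rfl
        · exact (hbar haU hB.2).symm
        · exact absurd haU (Finset.disjoint_left.1 h1.2.1 hB.2)
      by_cases haU' : a ∈ barImage U
      · refine ⟨barImage U, ⟨mem_glueParts.2 (Or.inr (Or.inl rfl)), haU'⟩, fun B hB => ?_⟩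
        rcases mem_glueParts.1 hB.1 with rfl | rfl | h1
        · exact absurd hB.2 haU
        · rfl
        · exact absurd haU' (Finset.disjoint_left.1 h1.2.2 hB.2)
      · obtain ⟨C, hC, haC⟩ := x.exists_block a
        refine ⟨C, ⟨mem_glueParts.2 (Or.inr (Or.inr ⟨hC,
          (h.subset_or_disjoint C hC).resolve_left fun h1 => haU (h1 haC),
          (h.subset_or_disjoint_bar C hC).resolve_left fun h1 => haU' (h1 haC)⟩)), haC⟩,
          fun B hB => ?_⟩
        rcases mem_glueParts.1 hB.1 with rfl | rfl | h1
        · exact absurd hB.2 haU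
        · exact absurd hB.2 haU'
        · exact eq_of_mem_blocks h1.1 hC hB.2 haC)
    (by
      rw [mem_glueParts]
      rintro (h1 | h1 | h1)
      · exact h.nonempty.ne_empty h1.symm
      · exact (barImage_nonempty h.nonempty).ne_empty h1.symm
      · exact (nonempty_of_mem_blocks h1.1).ne_empty rfl)
  sign B := if B ∈ glueParts x U ∧ barImage B = B then some default else none
  sign_eq_none B hB := if_neg fun h' => hB h'.1
  sign_injective B C σ hB hC := by
    have hB' : B ∈ glueParts x U ∧ barImage B = B := by
      by_contra h'
      simp [h'] at hB
    have hC' : C ∈ glueParts x U ∧ barImage C = C := by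
      by_contra h'
      simp [h'] at hC
    -- An invariant `U` contains any signed block of `x` and is then the only invariant block; if
    -- `U` is not invariant, the invariant blocks are old ones.
    have key : ∀ B, B ∈ glueParts x U → barImage B = B →
        (B = U ∧ barImage U = U) ∨ (barImage U ≠ U ∧ B ∈ x.blocks) := by
      intro B hB hBB
      by_cases hU : barImage U = U
      · refine Or.inl ⟨?_, hU⟩
        rcases mem_glueParts.1 hB with h1 | h1 | h1
        · exact h1
        · rw [h1, hU]
        · obtain ⟨a, ha⟩ := nonempty_of_mem_blocks h1.1
          exact absurd (h.signed hU B h1.1 hBB ha) (Finset.disjoint_left.1 h1.2.1 ha)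
      · refine Or.inr ⟨hU, ?_⟩
        rcases mem_glueParts.1 hB with h1 | h1 | h1
        · exact absurd (h1 ▸ hBB) hU
        · rw [h1, barImage_barImage] at hBB
          exact absurd hBB.symm hU
        · exact h1.1
    rcases key B hB'.1 hB'.2 with ⟨h1, h2⟩ | ⟨h1, h2⟩ <;>
      rcases key C hC'.1 hC'.2 with ⟨h3, h4⟩ | ⟨h3, h4⟩
    · rw [h1, h3]
    · exact absurd h2 h3
    · exact absurd h4 h1
    · exact eq_of_barImage_eq h2 hB'.2 h4 hC'.2
  bar_mem B hB := barImage_mem_glueParts hB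
  bar_eq_iff B hB := by
    have hB' : B ∈ glueParts x U := hB
    by_cases hBB : barImage B = B <;> simp [hB', hBB]

/-! ### Order properties of the glued partition -/

section Glue

variable {x : LabeledPartition n S} {U : Finset (BarSet n)} (h : x.Gluable U)

theorem mem_glue_blocks {B : Finset (BarSet n)} : B ∈ (x.glue U h).blocks ↔
    B = U ∨ B = barImage U ∨ B ∈ x.blocks ∧ Disjoint B U ∧ Disjoint B (barImage U) :=
  mem_glueParts

theorem mem_glue_self : U ∈ (x.glue U h).blocks := (mem_glue_blocks h).2 (Or.inl rfl)

theorem le_glue : x ≤ x.glue U h := by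
  rw [le_iff_blocks]
  intro B hB
  rcases h.subset_or_disjoint B hB with h1 | h1
  · exact ⟨U, mem_glue_self h, h1⟩
  rcases h.subset_or_disjoint_bar B hB with h2 | h2
  · exact ⟨_, barImage_mem_blocks (mem_glue_self h), h2⟩
  · exact ⟨B, (mem_glue_blocks h).2 (Or.inr (Or.inr ⟨hB, h1, h2⟩)), subset_rfl⟩

/-- With `le_glue`: gluing produces the least partition above `x` that has a block containing `U`.
-/
theorem glue_le {z : LabeledPartition n S} (hz : x ≤ z) {C : Finset (BarSet n)}
    (hC : C ∈ z.blocks) (hUC : U ⊆ C) : x.glue U h ≤ z := by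
  rw [le_iff_blocks]
  intro B hB
  rcases (mem_glue_blocks h).1 hB with rfl | rfl | h1
  · exact ⟨C, hC, hUC⟩
  · exact ⟨_, barImage_mem_blocks hC, barImage_mono hUC⟩
  · exact exists_superset hz h1.1

theorem lt_glue (hU : U ∉ x.blocks) : x < x.glue U h :=
  lt_of_le_of_ne (le_glue h) fun h' => hU (h' ▸ mem_glue_self h)

/-- An element strictly between has a block that is new over `x`. It lies in `U` or `barImage U`, so
by `hmin` it or its bar image is all of `U`, and the element already lies above the glued partition.
-/
theorem glue_covBy (hx : x ∈ typeD n S) (hy : x.glue U h ∈ typeD n S) (hU : U ∉ x.blocks)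
    (hmin : ∀ z, x ≤ z → ∀ C ∈ z.blocks, C ⊆ U → C ∉ x.blocks → C = U) :
    (⟨x, hx⟩ : typeD n S) ⋖ ⟨x.glue U h, hy⟩ := by
  refine ⟨lt_glue h hU, ?_⟩
  rintro ⟨z, hz⟩ hxz hzy
  replace hxz : x < z := hxz
  replace hzy : z < x.glue U h := hzy
  obtain ⟨C, hC, hCx⟩ : ∃ C ∈ z.blocks, C ∉ x.blocks := by
    by_contra! hcon
    exact hxz.not_ge (le_iff_blocks.2 fun C hC => ⟨C, hcon C hC, subset_rfl⟩)
  obtain ⟨D, hD, hCD⟩ := exists_superset hzy.le hC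
  rcases (mem_glue_blocks h).1 hD with rfl | rfl | h1
  · obtain rfl := hmin z hxz.le C hC hCD hCx
    exact hzy.not_ge (glue_le h hxz.le hC subset_rfl)
  · have h2 := hmin z hxz.le _ (barImage_mem_blocks hC) (barImage_subset_iff.2 hCD)
      fun h3 => hCx (by simpa using barImage_mem_blocks h3)
    exact hzy.not_ge (glue_le h hxz.le (barImage_mem_blocks hC) h2.ge)
  · obtain ⟨a, ha⟩ := nonempty_of_mem_blocks hC
    obtain ⟨B, hB, haB⟩ := x.exists_block a
    have hBC := subset_of_le hxz.le hB hC haB ha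
    have hBD := eq_of_mem_blocks hB h1.1 haB (hCD ha)
    exact hCx (subset_antisymm hBC (hBD ▸ hCD) ▸ hB)

theorem union_eq_of_mem_glue {A B : Finset (BarSet n)} (hA : A ∈ x.blocks) (hB : B ∈ x.blocks)
    (hAB : A ≠ B) (hAB' : A ∪ B ∈ (x.glue U h).blocks) : A ∪ B = U ∨ A ∪ B = barImage U := by
  rcases (mem_glue_blocks h).1 hAB' with h1 | h1 | h1
  · exact Or.inl h1
  · exact Or.inr h1
  · exact absurd h1.1 (union_notMem_blocks hA hB hAB)

end Glue

end LabeledPartition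

namespace LabeledPartition

variable {n : ℕ} {S : Type*}

/-! ### Leaders -/

section Leaders

variable {x : LabeledPartition n S} {u v : Fin n}

theorem block_mem (x : LabeledPartition n S) (v : Fin n) : x.block v ∈ x.blocks :=
  x.toPartition.part_mem.2 (Finset.mem_univ _)

theorem mem_block (x : LabeledPartition n S) (v : Fin n) : (v, false) ∈ x.block v :=
  x.toPartition.mem_part_self.2 (Finset.mem_univ _)

theorem block_eq {B : Finset (BarSet n)} (hB : B ∈ x.blocks) (hv : (v, false) ∈ B) :
    x.block v = B :=
  x.toPartition.part_eq_of_mem hB hv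

theorem mem_leaders :
    v ∈ x.leaders ↔ barImage (x.block v) ≠ x.block v ∧ ∀ a ∈ x.block v, v ≤ a.1 := by
  simp [leaders]

theorem mem_bigLeaders : v ∈ x.bigLeaders ↔ v ∈ x.leaders ∧ (x.block v).card ≠ 1 := by
  simp [bigLeaders]

theorem bigLeaders_subset (x : LabeledPartition n S) : x.bigLeaders ⊆ x.leaders :=
  Finset.filter_subset _ _

theorem block_inj (hu : u ∈ x.leaders) (hv : v ∈ x.leaders) (h : x.block u = x.block v) :
    u = v :=
  le_antisymm ((mem_leaders.1 hu).2 _ (h ▸ x.mem_block v))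
    ((mem_leaders.1 hv).2 _ (h ▸ x.mem_block u))

/-- Bar images share their least index, so `u = v` and the block would be invariant. Thus each pair
of unsigned blocks $B,\bar B$ has only one leader. -/
theorem block_ne_barImage_block (hu : u ∈ x.leaders) (hv : v ∈ x.leaders) :
    x.block u ≠ barImage (x.block v) := by
  intro h
  obtain rfl : u = v := by
    refine le_antisymm ((mem_leaders.1 hu).2 (barElt (v, false)) ?_)
      ((mem_leaders.1 hv).2 (barElt (u, false)) ?_)
    · rw [h, mem_barImage, barElt_barElt]
      exact x.mem_block v
    · rw [← mem_barImage, ← h]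
      exact x.mem_block u
  exact (mem_leaders.1 hu).1 h.symm

theorem exists_leader {B : Finset (BarSet n)} (hB : B ∈ x.blocks) (h : barImage B ≠ B) :
    ∃ v ∈ x.leaders, B = x.block v ∨ B = barImage (x.block v) := by
  obtain ⟨⟨v, b⟩, ha, hmin⟩ := Finset.exists_min_image B Prod.fst (nonempty_of_mem_blocks hB)
  cases b with
  | false =>
    have hv := block_eq hB ha
    exact ⟨v, mem_leaders.2 (by rw [hv]; exact ⟨h, hmin⟩), Or.inl hv.symm⟩
  | true =>
    have hv : x.block v = barImage B := block_eq (barImage_mem_blocks hB) (mem_barImage.2 ha)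
    refine ⟨v, mem_leaders.2 ?_, Or.inr (by rw [hv, barImage_barImage])⟩
    rw [hv]
    refine ⟨?_, fun a ha => hmin (barElt a) (mem_barImage.1 ha)⟩
    rw [barImage_barImage]
    exact h.symm

/-- Representatives count from `1` and `Fin n` from `0`; this is the shift in every label below. -/
theorem representative_block (hv : v ∈ x.leaders) : representative (x.block v) = v + 1 := by
  refine IsLeast.csInf_eq ⟨⟨_, x.mem_block v, rfl⟩, ?_⟩
  rintro _ ⟨a, ha, rfl⟩
  exact Nat.succ_le_succ ((mem_leaders.1 hv).2 a ha)

theorem representative_barImage (B : Finset (BarSet n)) :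
    representative (barImage B) = representative B := by
  unfold representative
  congr 1
  ext i
  constructor
  · rintro ⟨a, ha, rfl⟩
    exact ⟨barElt a, mem_barImage.1 ha, rfl⟩
  · rintro ⟨a, ha, rfl⟩
    exact ⟨barElt a, mem_barImage.2 (by simpa using ha), rfl⟩

theorem isUnsignedBlock_block (hv : v ∈ x.leaders) : x.IsUnsignedBlock (x.block v) :=
  isUnsignedBlock_iff.2 ⟨x.block_mem v, (mem_leaders.1 hv).1⟩

theorem isNormalized_block (hv : v ∈ x.leaders) : IsNormalized (x.block v) :=
  ⟨(v, false), x.mem_block v, rfl, (representative_block hv).symm⟩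

/-- Of $B$ and $\bar B$, only the one containing the leader unbarred is normalized. -/
theorem exists_eq_block {R : Finset (BarSet n)} (hR : x.IsUnsignedBlock R)
    (hR' : IsNormalized R) : ∃ v ∈ x.leaders, R = x.block v := by
  obtain ⟨hRx, hRR⟩ := isUnsignedBlock_iff.1 hR
  obtain ⟨v, hv, rfl | rfl⟩ := exists_leader hRx hRR
  · exact ⟨v, hv, rfl⟩
  · exfalso
    obtain ⟨⟨w, b⟩, hw, hb, hwr⟩ := hR'
    rw [representative_barImage, representative_block hv] at hwr
    obtain rfl : w = v := Fin.ext (Nat.succ_injective hwr)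
    obtain rfl : b = false := hb
    exact hRR (by rw [barImage_barImage]; exact block_eq hRx hw)

end Leaders

/-! ### Edge labels -/

/-- The block obtained by merging the blocks of `u` and `v` non-coherently. -/
noncomputable def mergedBlock (x : LabeledPartition n S) (u v : Fin n) : Finset (BarSet n) :=
  x.block u ∪ barImage (x.block v)

theorem barImage_mergedBlock (x : LabeledPartition n S) (u v : Fin n) :
    barImage (x.mergedBlock u v) = x.mergedBlock v u := by
  rw [mergedBlock, barImage_union, barImage_barImage, Finset.union_comm]
  rfl

theorem isCoherentMerge_iff {x y : LabeledPartition n S} {R R' : Finset (BarSet n)} :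
    IsCoherentMerge x y R R' ↔ ∃ u ∈ x.leaders, ∃ v ∈ x.leaders, u ≠ v ∧ R = x.block u ∧
      R' = x.block v ∧ x.block u ∪ x.block v ∈ y.blocks := by
  constructor
  · rintro ⟨h1, h2, h3, h4, h5, h6⟩
    obtain ⟨u, hu, rfl⟩ := exists_eq_block h2 h4
    obtain ⟨v, hv, rfl⟩ := exists_eq_block h3 h5
    exact ⟨u, hu, v, hv, fun h => h1 (by rw [h]), rfl, rfl, h6⟩
  · rintro ⟨u, hu, v, hv, huv, rfl, rfl, h⟩
    exact ⟨fun h' => huv (block_inj hu hv h'), isUnsignedBlock_block hu, isUnsignedBlock_block hv,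
      isNormalized_block hu, isNormalized_block hv, h⟩

theorem isNonCoherentMerge_iff {x y : LabeledPartition n S} {R R' : Finset (BarSet n)} :
    IsNonCoherentMerge x y R R' ↔ ∃ u ∈ x.leaders, ∃ v ∈ x.leaders, u ≠ v ∧ R = x.block u ∧
      R' = x.block v ∧ x.mergedBlock u v ∈ y.blocks := by
  constructor
  · rintro ⟨h1, h2, h3, h4, h5, h6⟩
    obtain ⟨u, hu, rfl⟩ := exists_eq_block h2 h4
    obtain ⟨v, hv, rfl⟩ := exists_eq_block h3 h5
    exact ⟨u, hu, v, hv, fun h => h1 (by rw [h]), rfl, rfl, h6⟩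
  · rintro ⟨u, hu, v, hv, huv, rfl, rfl, h⟩
    exact ⟨fun h' => huv (block_inj hu hv h'), isUnsignedBlock_block hu, isUnsignedBlock_block hv,
      isNormalized_block hu, isNormalized_block hv, h⟩

variable [LinearOrder S] [Unique S]

theorem signRank_eq_one (x : LabeledPartition n S) (σ : S) : x.signRank σ = 1 := by
  have key : ∀ s : Set S, σ ∈ s → s.ncard = 1 := fun s hs =>
    Set.ncard_eq_one.2 ⟨σ, Set.eq_singleton_iff_unique_mem.2 ⟨hs, fun _ _ => Subsingleton.elim _ _⟩⟩
  unfold signRank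
  split_ifs with h
  · exact key _ ⟨h, le_rfl⟩
  · exact key _ (Or.inl le_rfl)

/-- For any pair `x`, `y`, so the default `(0, 0)` must be listed. For coherent merges the first
coordinate suffices: it puts the label below `(1, 1)`. -/
theorem edgeLabel_cases (x y : LabeledPartition n S) :
    (∃ u ∈ x.leaders, ∃ v ∈ x.leaders, u ≠ v ∧ x.block u ∪ x.block v ∈ y.blocks ∧
      ∃ m, edgeLabel x y = toLex (0, m)) ∨
    (∃ u ∈ x.leaders, ∃ v ∈ x.leaders, u < v ∧ x.mergedBlock u v ∈ y.blocks ∧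
      edgeLabel x y = toLex (2, (u : ℕ) + 1)) ∨
    ((∃ σ, x.signedBlock σ ⊂ y.signedBlock σ) ∧ edgeLabel x y = toLex (1, 1)) ∨
    ((∀ u ∈ x.leaders, ∀ v ∈ x.leaders, u ≠ v → x.mergedBlock u v ∉ y.blocks) ∧
      (¬ ∃ σ, x.signedBlock σ ⊂ y.signedBlock σ) ∧ edgeLabel x y = toLex (0, 0)) := by
  unfold edgeLabel
  split_ifs with h1 h2 h3
  · left
    obtain ⟨u, hu, v, hv, huv, -, -, h⟩ := isCoherentMerge_iff.1 h1.choose_spec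
    exact ⟨u, hu, v, hv, huv, h, _, rfl⟩
  · right; left
    obtain ⟨u, hu, v, hv, huv, hR, hR', h⟩ := isNonCoherentMerge_iff.1 h2.choose_spec
    rw [hR, hR', representative_block hu, representative_block hv]
    -- Exchanging `u` and `v` replaces the merged block by its bar image, so the smaller one may
    -- come first.
    rcases huv.lt_or_gt with huv | huv
    · refine ⟨u, hu, v, hv, huv, h, ?_⟩
      rw [min_eq_left (by have := Fin.lt_def.1 huv; lia)]
    · refine ⟨v, hv, u, hu, huv, ?_, ?_⟩
      · rw [← barImage_mergedBlock]
        exact barImage_mem_blocks h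
      · rw [min_eq_right (by have := Fin.lt_def.1 huv; lia)]
  · right; right; left
    exact ⟨h3, by rw [signRank_eq_one]⟩
  · right; right; right
    refine ⟨fun u hu v hv huv h => h2 ⟨(x.block u, x.block v), ?_⟩, h3, rfl⟩
    exact isNonCoherentMerge_iff.2 ⟨u, hu, v, hv, huv, rfl, rfl, h⟩

end LabeledPartition

namespace LabeledPartition

variable {n : ℕ} {S : Type*}

/-! ### Unions of blocks -/

section Unions

variable {x : LabeledPartition n S}

theorem subset_or_disjoint_of_mem {A : Finset (BarSet n)} (hA : A ∈ x.blocks) :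
    ∀ B ∈ x.blocks, B ⊆ A ∨ Disjoint B A := fun B hB => by
  by_cases h : B = A
  · exact Or.inl h.subset
  · exact Or.inr (disjoint_of_ne hB hA h)

theorem subset_or_disjoint_union {A C : Finset (BarSet n)}
    (hA : ∀ B ∈ x.blocks, B ⊆ A ∨ Disjoint B A) (hC : ∀ B ∈ x.blocks, B ⊆ C ∨ Disjoint B C) :
    ∀ B ∈ x.blocks, B ⊆ A ∪ C ∨ Disjoint B (A ∪ C) := fun B hB => by
  rcases hA B hB with h1 | h1
  · exact Or.inl (h1.trans Finset.subset_union_left)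
  rcases hC B hB with h2 | h2
  · exact Or.inl (h2.trans Finset.subset_union_right)
  · exact Or.inr (Finset.disjoint_union_right.2 ⟨h1, h2⟩)

/-- A block of `z` is a union of blocks of `x`; being new, it needs at least two. -/
theorem exists_two_blocks {z : LabeledPartition n S} (hxz : ∀ B ∈ x.blocks, ∃ C ∈ z.blocks, B ⊆ C)
    {C : Finset (BarSet n)} (hC : C ∈ z.blocks) (hCx : C ∉ x.blocks) :
    ∃ B ∈ x.blocks, ∃ B' ∈ x.blocks, B ≠ B' ∧ B ⊆ C ∧ B' ⊆ C := by
  have key : ∀ a ∈ C, ∃ B ∈ x.blocks, a ∈ B ∧ B ⊆ C := by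
    intro a ha
    obtain ⟨B, hB, haB⟩ := x.exists_block a
    obtain ⟨D, hD, hBD⟩ := hxz B hB
    exact ⟨B, hB, haB, eq_of_mem_blocks hD hC (hBD haB) ha ▸ hBD⟩
  obtain ⟨a, ha⟩ := nonempty_of_mem_blocks hC
  obtain ⟨B, hB, -, hBC⟩ := key a ha
  obtain ⟨b, hb, hbB⟩ : ∃ b ∈ C, b ∉ B := by
    by_contra! hcon
    exact hCx (subset_antisymm hBC hcon ▸ hB)
  obtain ⟨B', hB', hbB', hBC'⟩ := key b hb
  exact ⟨B, hB, B', hB', fun h => hbB (h ▸ hbB'), hBC, hBC'⟩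

theorem barImage_eq_of_subset {C : Finset (BarSet n)} (hC : C ∈ x.blocks) {B : Finset (BarSet n)}
    (hB : B.Nonempty) (h1 : B ⊆ C) (h2 : barImage B ⊆ C) : barImage C = C := by
  obtain ⟨a, ha⟩ := hB
  exact eq_of_mem_blocks (barImage_mem_blocks hC) hC (a := a) (mem_barImage.2 (h2 (by simpa))) (h1 ha)

theorem mem_typeD_of_not_isSigned (hx : ¬ x.IsSigned) : x ∈ typeD n S := fun σ => by
  rw [signedBlock_eq_empty hx]
  simp

end Unions

section MergedBlock

variable {x : LabeledPartition n S} {u v : Fin n}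

theorem mergedBlock_ne (hu : u ∈ x.leaders) (hv : v ∈ x.leaders) : x.mergedBlock u v ∉ x.blocks :=
  union_notMem_blocks (x.block_mem u) (barImage_mem_blocks (x.block_mem v))
    (block_ne_barImage_block hu hv)

theorem gluable_mergedBlock (hx : ¬ x.IsSigned) (hu : u ∈ x.leaders) (hv : v ∈ x.leaders)
    (huv : u ≠ v) : x.Gluable (x.mergedBlock u v) where
  nonempty := (nonempty_of_mem_blocks (x.block_mem u)).mono Finset.subset_union_left
  subset_or_disjoint := subset_or_disjoint_union (subset_or_disjoint_of_mem (x.block_mem u))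
    (subset_or_disjoint_of_mem (barImage_mem_blocks (x.block_mem v)))
  bar := by
    right
    have hbu := barImage_mem_blocks (x.block_mem u)
    have hbv := barImage_mem_blocks (x.block_mem v)
    rw [barImage_mergedBlock, mergedBlock, mergedBlock, Finset.disjoint_union_left,
      Finset.disjoint_union_right, Finset.disjoint_union_right]
    exact ⟨⟨disjoint_of_ne (x.block_mem u) (x.block_mem v) fun h => huv (block_inj hu hv h),
      disjoint_barImage (x.block_mem u) (mem_leaders.1 hu).1⟩,
      (disjoint_barImage (x.block_mem v) (mem_leaders.1 hv).1).symm,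
      disjoint_of_ne hbv hbu fun h => huv (block_inj hu hv (barImage_inj.1 h).symm)⟩
  signed _ B hB hBB := absurd ⟨B, hB, hBB⟩ hx

/-- The properties of the partition obtained from `x` by merging the blocks of `u` and `v`
non-coherently. -/
structure IsMerge [LinearOrder S] (x y : typeD n S) (u v : Fin n) : Prop where
  covBy : x ⋖ y
  not_isSigned : ¬ y.1.IsSigned
  label : edgeLabel x.1 y.1 = toLex (2, (u : ℕ) + 1)
  leaders : y.1.leaders = x.1.leaders.erase v
  bigLeaders : y.1.bigLeaders = insert u (x.1.bigLeaders.erase v)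
  le : ∀ z, x.1 ≤ z → ∀ C ∈ z.blocks, x.1.mergedBlock u v ⊆ C → y.1 ≤ z

theorem union_eq_mergedBlock {A B : Finset (BarSet n)} (hA : A ∈ x.blocks) (hB : B ∈ x.blocks) (hAB : A ≠ B)
    (h : A ∪ B = x.mergedBlock u v) :
    A = x.block u ∧ B = barImage (x.block v) ∨ A = barImage (x.block v) ∧ B = x.block u :=
  union_eq_union hA hB (x.block_mem u) (barImage_mem_blocks (x.block_mem v)) hAB h

end MergedBlock

variable [Unique S]

/-! ### Leaders of the glued partition -/

section GlueLeaders

variable {x : LabeledPartition n S} {U : Finset (BarSet n)} (h : x.Gluable U) {w : Fin n}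

theorem block_glue_of_notMem (h1 : (w, false) ∉ U) (h2 : (w, false) ∉ barImage U) :
    (x.glue U h).block w = x.block w := by
  refine block_eq ((mem_glue_blocks h).2 (Or.inr (Or.inr ⟨x.block_mem w, ?_, ?_⟩))) (x.mem_block w)
  · exact (h.subset_or_disjoint _ (x.block_mem w)).resolve_left fun h3 => h1 (h3 (x.mem_block w))
  · exact (h.subset_or_disjoint_bar _ (x.block_mem w)).resolve_left fun h3 =>
      h2 (h3 (x.mem_block w))

theorem block_glue_of_mem (h1 : (w, false) ∈ U) : (x.glue U h).block w = U :=
  block_eq (mem_glue_self h) h1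

theorem block_glue_of_mem_barImage (h1 : (w, false) ∈ barImage U) :
    (x.glue U h).block w = barImage U :=
  block_eq (barImage_mem_blocks (mem_glue_self h)) h1

theorem mem_leaders_glue_of_notMem (h1 : (w, false) ∉ U) (h2 : (w, false) ∉ barImage U) :
    w ∈ (x.glue U h).leaders ↔ w ∈ x.leaders := by
  rw [mem_leaders, mem_leaders, block_glue_of_notMem h h1 h2]

end GlueLeaders

/-! ### Non-coherent merges -/

section Merge

variable {x : LabeledPartition n S} {u v : Fin n}

theorem not_isSigned_glue (hx : ¬ x.IsSigned) (hu : u ∈ x.leaders) (hv : v ∈ x.leaders)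
    (huv : u ≠ v) : ¬ (x.glue _ (gluable_mergedBlock hx hu hv huv)).IsSigned := by
  have hg := gluable_mergedBlock hx hu hv huv
  have hU : barImage (x.mergedBlock u v) ≠ x.mergedBlock u v := fun h => by
    rcases hg.bar with - | h'
    · rw [barImage_mergedBlock] at h
      rcases union_eq_union (x.block_mem v) (barImage_mem_blocks (x.block_mem u)) (x.block_mem u)
        (barImage_mem_blocks (x.block_mem v)) (block_ne_barImage_block hv hu) h with h1 | h1
      · exact huv (block_inj hu hv h1.1.symm)
      · exact (mem_leaders.1 hv).1 h1.1.symm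
    · rw [h, disjoint_self, Finset.bot_eq_empty] at h'
      exact hg.nonempty.ne_empty h'
  rintro ⟨B, hB, hBB⟩
  rcases (mem_glue_blocks hg).1 hB with rfl | rfl | h1
  · exact hU hBB
  · rw [barImage_barImage] at hBB
    exact hU hBB.symm
  · exact hx ⟨B, h1.1, hBB⟩

/-- The merged block consists of only two old blocks, so nothing fits in between. As `u < v`, its
least index is `u`; the index `v` stops being a leader. -/
theorem exists_isMerge [LinearOrder S] {x : typeD n S} (hx : ¬ x.1.IsSigned)
    (hu : u ∈ x.1.leaders) (hv : v ∈ x.1.leaders) (huv : u < v) : ∃ y, IsMerge x y u v := by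
  obtain ⟨x, hxD⟩ := x
  change ¬ x.IsSigned at hx
  change u ∈ x.leaders at hu
  change v ∈ x.leaders at hv
  have hg := gluable_mergedBlock hx hu hv huv.ne
  have hy : ¬ (x.glue _ hg).IsSigned := not_isSigned_glue hx hu hv huv.ne
  have hbarU : barImage (x.mergedBlock u v) = x.mergedBlock v u := barImage_mergedBlock u v (x := x)
  have hnotSigned : ∀ B ∈ (x.glue _ hg).blocks, barImage B ≠ B := fun B hB hBB => hy ⟨B, hB, hBB⟩
  -- The block of `v` enters barred, so among the old leaders only `u` lies unbarred in the merged
  -- block.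
  have hwu : ∀ w ∈ x.leaders, (w, false) ∈ x.mergedBlock u v → w = u := by
    intro w hw hwU
    rcases Finset.mem_union.1 hwU with h | h
    · exact block_inj hw hu (block_eq (x.block_mem u) h)
    · exact absurd (block_eq (barImage_mem_blocks (x.block_mem v)) h)
        (block_ne_barImage_block hw hv)
  have hwv : ∀ w ∈ x.leaders, (w, false) ∈ x.mergedBlock v u → w = v := by
    intro w hw hwU
    rcases Finset.mem_union.1 hwU with h | h
    · exact block_inj hw hv (block_eq (x.block_mem v) h)
    · exact absurd (block_eq (barImage_mem_blocks (x.block_mem u)) h)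
        (block_ne_barImage_block hw hu)
  have hminU : ∀ a ∈ x.mergedBlock u v, u ≤ a.1 := by
    intro a ha
    rcases Finset.mem_union.1 ha with h | h
    · exact (mem_leaders.1 hu).2 a h
    · exact huv.le.trans ((mem_leaders.1 hv).2 (barElt a) (mem_barImage.1 h))
  have huU : (u, false) ∈ x.mergedBlock u v := Finset.mem_union_left _ (x.mem_block u)
  have hvU : (v, false) ∈ x.mergedBlock v u := Finset.mem_union_left _ (x.mem_block v)
  have hu' : u ∈ (x.glue _ hg).leaders := mem_leaders.2
    ⟨hnotSigned _ (block_mem _ _), by rw [block_glue_of_mem hg huU]; exact hminU⟩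
  have hleaders : (x.glue _ hg).leaders = x.leaders.erase v := by
    ext w
    rw [Finset.mem_erase]
    by_cases h1 : (w, false) ∈ x.mergedBlock u v
    · constructor
      · intro hw
        obtain rfl : w = u := block_inj hw hu' (by
          rw [block_glue_of_mem hg h1, block_glue_of_mem hg huU])
        exact ⟨huv.ne, hu⟩
      · rintro ⟨-, hw⟩
        rwa [hwu w hw h1]
    by_cases h2 : (w, false) ∈ x.mergedBlock v u
    · constructor
      · intro hw
        refine absurd ?_ (block_ne_barImage_block hw hu')
        rw [block_glue_of_mem hg huU, block_glue_of_mem_barImage hg (hbarU ▸ h2)]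
      · rintro ⟨hwv', hw⟩
        exact absurd (hwv w hw h2) hwv'
    · rw [mem_leaders_glue_of_notMem hg h1 (hbarU ▸ h2)]
      exact ⟨fun hw => ⟨fun h => h2 (h ▸ hvU), hw⟩, fun hw => hw.2⟩
  refine ⟨⟨x.glue _ hg, mem_typeD_of_not_isSigned hy⟩, ?_, hy, ?_, hleaders, ?_, ?_⟩
  · refine glue_covBy hg hxD _ (mergedBlock_ne hu hv) fun z hxz C hC hCU hCx => ?_
    refine subset_antisymm hCU ?_
    obtain ⟨B, hB, B', hB', hBB', hBC, hBC'⟩ := exists_two_blocks (le_iff_blocks.1 hxz) hC hCx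
    have key : ∀ B ∈ x.blocks, B ⊆ C → B = x.block u ∨ B = barImage (x.block v) :=
      fun B hB hBC => eq_or_eq_of_subset_union (x.block_mem u)
        (barImage_mem_blocks (x.block_mem v)) hB (hBC.trans hCU)
    rcases key B hB hBC with rfl | rfl <;> rcases key B' hB' hBC' with rfl | rfl
    · exact absurd rfl hBB'
    · exact Finset.union_subset hBC hBC'
    · exact Finset.union_subset hBC' hBC
    · exact absurd rfl hBB'
  · change edgeLabel x (x.glue _ hg) = _
    -- The two old blocks making up the new block are determined up to order and bar, which leaves
    -- only the label coming from `u`.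
    rcases edgeLabel_cases x (x.glue _ hg) with ⟨a, ha, b, hb, hab, hU, -⟩ |
      ⟨a, ha, b, hb, hab, hU, hl⟩ | ⟨⟨σ, hσ⟩, -⟩ | ⟨h1, -⟩
    · exfalso
      have hne : x.block a ≠ x.block b := fun h => hab (block_inj ha hb h)
      rcases union_eq_of_mem_glue hg (x.block_mem a) (x.block_mem b) hne hU with h | h
      · rcases union_eq_mergedBlock (x.block_mem a) (x.block_mem b) hne h with h' | h'
        · exact block_ne_barImage_block hb hv h'.2
        · exact block_ne_barImage_block ha hv h'.1
      · rw [hbarU] at h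
        rcases union_eq_mergedBlock (x.block_mem a) (x.block_mem b) hne h with h' | h'
        · exact block_ne_barImage_block hb hu h'.2
        · exact block_ne_barImage_block ha hu h'.1
    · have hb' := barImage_mem_blocks (x.block_mem b)
      have hne := block_ne_barImage_block ha hb
      rcases union_eq_of_mem_glue hg (x.block_mem a) hb' hne hU with h | h
      · rcases union_eq_mergedBlock (x.block_mem a) hb' hne h with h' | h'
        · rw [hl, block_inj ha hu h'.1]
        · exact absurd h'.1 (block_ne_barImage_block ha hv)
      · rw [hbarU] at h
        rcases union_eq_mergedBlock (x.block_mem a) hb' hne h with h' | h'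
        · rw [block_inj ha hv h'.1, block_inj hb hu (barImage_inj.1 h'.2)] at hab
          exact absurd hab huv.not_gt
        · exact absurd h'.1 (block_ne_barImage_block ha hu)
    · rw [signedBlock_eq_empty hy] at hσ
      exact absurd hσ (Finset.not_ssubset_empty _)
    · exact absurd (mem_glue_self hg) (h1 u hu v hv huv.ne)
  · ext w
    change w ∈ (x.glue _ hg).bigLeaders ↔ _
    rw [mem_bigLeaders, hleaders, Finset.mem_insert, Finset.mem_erase, Finset.mem_erase,
      mem_bigLeaders]
    by_cases hwu' : w = u
    · subst hwu'
      refine ⟨fun _ => Or.inl rfl, fun _ => ⟨⟨huv.ne, hu⟩, ?_⟩⟩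
      rw [block_glue_of_mem hg huU, mergedBlock, Finset.card_union_of_disjoint (disjoint_of_ne
        (x.block_mem w) (barImage_mem_blocks (x.block_mem v)) (block_ne_barImage_block hu hv))]
      have h1 := Finset.card_pos.2 (nonempty_of_mem_blocks (x.block_mem w))
      have h2 := Finset.card_pos.2
        (nonempty_of_mem_blocks (barImage_mem_blocks (x.block_mem v)))
      lia
    · have hblock : w ∈ x.leaders → w ≠ v → (x.glue _ hg).block w = x.block w := fun hw hwv' =>
        block_glue_of_notMem hg (fun h => hwu' (hwu w hw h))
          fun h => hwv' (hwv w hw (hbarU ▸ h))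
      constructor
      · rintro ⟨⟨hwv', hw⟩, hc⟩
        exact Or.inr ⟨hwv', hw, by rwa [← hblock hw hwv']⟩
      · rintro (h | ⟨hwv', hw, hc⟩)
        · exact absurd h hwu'
        · exact ⟨⟨hwv', hw⟩, by rwa [hblock hw hwv']⟩
  · exact fun z hxz C hC hUC => glue_le hg hxz hC hUC

end Merge

/-! ### Enlarging the signed block -/

section Absorb

variable {x : LabeledPartition n S} {v : Fin n}

/-- The union of the signed block with the block of `v` and its image under the involution. -/
noncomputable def absorbedBlock (x : LabeledPartition n S) (v : Fin n) : Finset (BarSet n) :=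
  x.signedBlock default ∪ (x.block v ∪ barImage (x.block v))

theorem barImage_absorbedBlock (x : LabeledPartition n S) (v : Fin n) :
    barImage (x.absorbedBlock v) = x.absorbedBlock v := by
  rw [absorbedBlock, barImage_union, barImage_union, barImage_barImage, barImage_signedBlock,
    Finset.union_comm (barImage _)]

theorem block_subset_absorbedBlock (x : LabeledPartition n S) (v : Fin n) :
    x.block v ⊆ x.absorbedBlock v :=
  Finset.subset_union_left.trans Finset.subset_union_right

theorem eq_of_subset_absorbedBlock {B : Finset (BarSet n)} (hB : B ∈ x.blocks)
    (h : B ⊆ x.absorbedBlock v) :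
    (x.IsSigned ∧ B = x.signedBlock default) ∨ B = x.block v ∨ B = barImage (x.block v) := by
  obtain ⟨a, ha⟩ := nonempty_of_mem_blocks hB
  rcases Finset.mem_union.1 (h ha) with h1 | h1
  · left
    have hx : x.IsSigned := by
      by_contra hx
      rw [signedBlock_eq_empty hx] at h1
      exact Finset.notMem_empty _ h1
    exact ⟨hx, eq_of_mem_blocks hB (hx.signedBlock_mem _) ha h1⟩
  · right
    exact (Finset.mem_union.1 h1).imp (eq_of_mem_blocks hB (x.block_mem v) ha)
      (eq_of_mem_blocks hB (barImage_mem_blocks (x.block_mem v)) ha)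

theorem gluable_absorbedBlock (x : LabeledPartition n S) (v : Fin n) :
    x.Gluable (x.absorbedBlock v) where
  nonempty := (nonempty_of_mem_blocks (x.block_mem v)).mono (x.block_subset_absorbedBlock v)
  subset_or_disjoint := by
    refine subset_or_disjoint_union ?_ (subset_or_disjoint_union
      (subset_or_disjoint_of_mem (x.block_mem v))
      (subset_or_disjoint_of_mem (barImage_mem_blocks (x.block_mem v))))
    by_cases hx : x.IsSigned
    · exact subset_or_disjoint_of_mem (hx.signedBlock_mem _)
    · rw [signedBlock_eq_empty hx]
      exact fun B _ => Or.inr (Finset.disjoint_empty_right B)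
  bar := Or.inl (x.barImage_absorbedBlock v)
  signed _ B hB hBB := by
    rw [absorbedBlock, signedBlock_of_barImage_eq hB hBB]
    exact Finset.subset_union_left

/-- The properties of the partition obtained from `x` by adding the block of `v` and its image under
the involution to the signed block. -/
structure IsAbsorb [LinearOrder S] (x y : typeD n S) (v : Fin n) : Prop where
  covBy : x ⋖ y
  isSigned : y.1.IsSigned
  label : edgeLabel x.1 y.1 = toLex (1, 1)
  leaders : y.1.leaders = x.1.leaders.erase v
  le : ∀ z, x.1 ≤ z → z.IsSigned → x.1.block v ⊆ z.signedBlock default → y.1 ≤ z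

theorem absorbedBlock_subset {z : LabeledPartition n S} (hxz : x ≤ z)
    (hv : x.block v ⊆ z.signedBlock default) : x.absorbedBlock v ⊆ z.signedBlock default := by
  refine Finset.union_subset ?_ (Finset.union_subset hv ?_)
  · by_cases hx : x.IsSigned
    · exact (isSigned_mono hxz hx).2 _
    · rw [signedBlock_eq_empty hx]
      exact Finset.empty_subset _
  · rw [← barImage_signedBlock]
    exact barImage_mono hv

/-- The size is that of the old signed block plus twice that of the block of `v`; it is `2` only
when a singleton enters an empty signed block. -/
theorem card_absorbedBlock_ne_two (hv : v ∈ x.leaders) (h : x.IsSigned ∨ v ∈ x.bigLeaders) :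
    (x.absorbedBlock v).card ≠ 2 := by
  have hb := barImage_mem_blocks (x.block_mem v)
  have h1 := Finset.card_pos.2 (nonempty_of_mem_blocks (x.block_mem v))
  have h2 : (x.block v ∪ barImage (x.block v)).card = 2 * (x.block v).card := by
    rw [Finset.card_union_of_disjoint (disjoint_barImage (x.block_mem v) (mem_leaders.1 hv).1),
      card_barImage]
    ring
  rcases h with h | h
  · have hS := h.signedBlock_mem default
    have hbar := x.barImage_signedBlock default
    have hd : Disjoint (x.signedBlock default) (x.block v ∪ barImage (x.block v)) := by
      refine Finset.disjoint_union_right.2 ⟨disjoint_of_ne hS (x.block_mem v) fun h' => ?_,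
        disjoint_of_ne hS hb fun h' => ?_⟩
      · exact (mem_leaders.1 hv).1 (h' ▸ hbar)
      · rw [h', barImage_barImage] at hbar
        exact (mem_leaders.1 hv).1 hbar.symm
    have h3 := Finset.card_pos.2 (nonempty_of_mem_blocks hS)
    rw [absorbedBlock, Finset.card_union_of_disjoint hd]
    lia
  · have h3 := (mem_bigLeaders.1 h).2
    have h4 := Finset.card_le_card (s := x.block v ∪ barImage (x.block v))
      (t := x.absorbedBlock v) Finset.subset_union_right
    lia

theorem exists_isAbsorb [LinearOrder S] {x : typeD n S} (hv : v ∈ x.1.leaders)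
    (h : x.1.IsSigned ∨ v ∈ x.1.bigLeaders) : ∃ y, IsAbsorb x y v := by
  obtain ⟨x, hxD⟩ := x
  change v ∈ x.leaders at hv
  change x.IsSigned ∨ v ∈ x.bigLeaders at h
  have hg := gluable_absorbedBlock x v
  have hU := x.barImage_absorbedBlock v
  have hself := mem_glue_self hg
  have hsigned : (x.glue _ hg).IsSigned := ⟨_, hself, hU⟩
  have hSB : ∀ σ, (x.glue _ hg).signedBlock σ = x.absorbedBlock v :=
    signedBlock_of_barImage_eq hself hU
  have hUx : x.absorbedBlock v ∉ x.blocks := fun h' => (mem_leaders.1 hv).1 (by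
    rw [eq_of_subset_blocks (x.block_mem v) h' (x.block_subset_absorbedBlock v), hU])
  have hbv := barImage_mem_blocks (x.block_mem v)
  have hyD : x.glue _ hg ∈ typeD n S := fun σ => by
    rw [hSB]
    exact card_absorbedBlock_ne_two hv h
  have hSne : ∀ B : Finset (BarSet n), barImage B ≠ B → B ≠ x.signedBlock default :=
    fun B hB h' => hB (by rw [h', barImage_signedBlock])
  have hpair : ∀ A ∈ x.blocks, ∀ B ∈ x.blocks, barImage A ≠ A → barImage B ≠ B → A ≠ B →
      A ∪ B ∈ (x.glue _ hg).blocks →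
      A = x.block v ∧ B = barImage (x.block v) ∨ A = barImage (x.block v) ∧ B = x.block v := by
    intro A hA B hB hAA hBB hAB hAB'
    have hABU : A ∪ B = x.absorbedBlock v :=
      (union_eq_of_mem_glue hg hA hB hAB hAB').elim id fun h' => h'.trans hU
    have h1 := (eq_of_subset_absorbedBlock hA (hABU ▸ Finset.subset_union_left)).resolve_left
      fun h' => hSne A hAA h'.2
    have h2 := (eq_of_subset_absorbedBlock hB (hABU ▸ Finset.subset_union_right)).resolve_left
      fun h' => hSne B hBB h'.2
    rcases h1 with rfl | rfl <;> rcases h2 with rfl | rfl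
    · exact absurd rfl hAB
    · exact Or.inl ⟨rfl, rfl⟩
    · exact Or.inr ⟨rfl, rfl⟩
    · exact absurd rfl hAB
  refine ⟨⟨x.glue _ hg, hyD⟩, ?_, hsigned, ?_, ?_, ?_⟩
  · refine glue_covBy hg hxD hyD hUx fun z hxz C hC hCU hCx => subset_antisymm hCU ?_
    obtain ⟨B, hB, B', hB', hBB', hBC, hBC'⟩ := exists_two_blocks (le_iff_blocks.1 hxz) hC hCx
    have hvne := nonempty_of_mem_blocks (x.block_mem v)
    -- Two distinct old blocks inside `C` either include the signed block or are the block of `v`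
    -- and its bar image.
    have hCC : barImage C = C := by
      rcases eq_of_subset_absorbedBlock hB (hBC.trans hCU) with ⟨-, h1⟩ | h1
      · refine barImage_eq_of_subset hC (nonempty_of_mem_blocks hB) hBC ?_
        rw [h1, barImage_signedBlock, ← h1]
        exact hBC
      rcases eq_of_subset_absorbedBlock hB' (hBC'.trans hCU) with ⟨-, h2⟩ | h2
      · refine barImage_eq_of_subset hC (nonempty_of_mem_blocks hB') hBC' ?_
        rw [h2, barImage_signedBlock, ← h2]
        exact hBC'
      rcases h1 with rfl | rfl <;> rcases h2 with rfl | rfl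
      · exact absurd rfl hBB'
      · exact barImage_eq_of_subset hC hvne hBC hBC'
      · exact barImage_eq_of_subset hC hvne hBC' hBC
      · exact absurd rfl hBB'
    have hCS := signedBlock_of_barImage_eq hC hCC default
    rw [← hCS]
    refine absorbedBlock_subset hxz ?_
    rw [hCS]
    have key : ∀ B ∈ x.blocks, B ⊆ C → x.block v ⊆ C ∨ x.IsSigned ∧ B = x.signedBlock default := by
      intro B hB hBC
      rcases eq_of_subset_absorbedBlock hB (hBC.trans hCU) with h1 | rfl | rfl
      · exact Or.inr h1
      · exact Or.inl hBC
      · rw [barImage_subset_iff, hCC] at hBC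
        exact Or.inl hBC
    rcases key B hB hBC with h1 | h1
    · exact h1
    rcases key B' hB' hBC' with h2 | h2
    · exact h2
    · exact absurd (h1.2.trans h2.2.symm) hBB'
  · change edgeLabel x (x.glue _ hg) = _
    rcases edgeLabel_cases x (x.glue _ hg) with ⟨a, ha, b, hb, hab, hab', -⟩ |
      ⟨a, ha, b, hb, hab, hab', -⟩ | ⟨-, hl⟩ | ⟨-, h2, -⟩
    · exfalso
      rcases hpair _ (x.block_mem a) _ (x.block_mem b) (mem_leaders.1 ha).1 (mem_leaders.1 hb).1
        (fun h => hab (block_inj ha hb h)) hab' with h' | h'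
      · exact block_ne_barImage_block hb hv h'.2
      · exact block_ne_barImage_block ha hv h'.1
    · exfalso
      rcases hpair _ (x.block_mem a) _ (barImage_mem_blocks (x.block_mem b)) (mem_leaders.1 ha).1
        (by rw [barImage_barImage]; exact (mem_leaders.1 hb).1.symm)
        (block_ne_barImage_block ha hb) hab' with h' | h'
      · exact hab.ne (block_inj ha hb (h'.1.trans (barImage_inj.1 h'.2).symm))
      · exact block_ne_barImage_block ha hv h'.1
    · exact hl
    · refine absurd ⟨default, ?_⟩ h2
      rw [hSB, Finset.ssubset_iff_subset_ne]
      refine ⟨Finset.subset_union_left, fun h' => hSne _ (mem_leaders.1 hv).1 ?_⟩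
      have hx : x.IsSigned := by
        by_contra hx
        rw [signedBlock_eq_empty hx] at h'
        exact hg.nonempty.ne_empty h'.symm
      exact eq_of_subset_blocks (x.block_mem v) (hx.signedBlock_mem _)
        (h' ▸ x.block_subset_absorbedBlock v)
  · ext w
    change w ∈ (x.glue _ hg).leaders ↔ w ∈ x.leaders.erase v
    rw [Finset.mem_erase]
    by_cases h1 : (w, false) ∈ x.absorbedBlock v
    · constructor
      · intro hw
        refine absurd ?_ (mem_leaders.1 hw).1
        rw [block_glue_of_mem hg h1, hU]
      · rintro ⟨hwv, hw⟩
        exfalso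
        have hsub : x.block w ⊆ x.absorbedBlock v :=
          (hg.subset_or_disjoint _ (x.block_mem w)).resolve_right fun h' =>
            Finset.disjoint_left.1 h' (x.mem_block w) h1
        rcases eq_of_subset_absorbedBlock (x.block_mem w) hsub with h' | h' | h'
        · exact hSne _ (mem_leaders.1 hw).1 h'.2
        · exact hwv (block_inj hw hv h')
        · exact block_ne_barImage_block hw hv h'
    · rw [mem_leaders_glue_of_notMem hg h1 (by rwa [hU])]
      refine ⟨fun hw => ⟨?_, hw⟩, fun hw => hw.2⟩
      rintro rfl
      exact h1 (x.block_subset_absorbedBlock w (x.mem_block w))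
  · exact fun z hxz hz hvz => glue_le hg hxz (hz.signedBlock_mem _) (absorbedBlock_subset hxz hvz)

end Absorb

end LabeledPartition

namespace LabeledPartition

variable {n : ℕ} {S : Type*}

/-- `y` is the least candidate and `z` covers `x`, so they coincide. -/
theorem IsMerge.eq [LinearOrder S] {x y z : typeD n S} {u v : Fin n} (h : IsMerge x y u v) (hxz : x ⋖ z)
    (hz : x.1.mergedBlock u v ∈ z.1.blocks) : y = z :=
  eq_of_le_of_not_lt (h.le z hxz.le _ hz subset_rfl) (hxz.2 h.covBy.lt)

/-! ### The least partition and `[n]_σ` -/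

theorem zeroHat_block (v : Fin n) : (zeroHat n S).block v = {(v, false)} :=
  block_eq (Finpartition.mem_bot_iff.2 ⟨_, Finset.mem_univ _, rfl⟩) (Finset.mem_singleton_self _)

theorem not_isSigned_zeroHat : ¬ (zeroHat n S).IsSigned := by
  rintro ⟨B, hB, hBB⟩
  obtain ⟨σ, hσ⟩ := ((zeroHat n S).bar_eq_iff B hB).1 hBB
  exact Option.some_ne_none σ hσ.symm

theorem leaders_zeroHat : (zeroHat n S).leaders = Finset.univ := by
  ext v
  rw [mem_leaders]
  refine iff_of_true ⟨fun h => not_isSigned_zeroHat ⟨_, block_mem _ v, h⟩, ?_⟩ (Finset.mem_univ v)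
  rw [zeroHat_block]
  simp

theorem bigLeaders_zeroHat : (zeroHat n S).bigLeaders = ∅ := by
  ext v
  rw [mem_bigLeaders, zeroHat_block]
  simp

theorem mem_full_blocks {hn : 1 ≤ n} {σ : S} {B : Finset (BarSet n)} :
    B ∈ (full hn σ).blocks ↔ B = Finset.univ := Finset.mem_singleton

theorem full_isSigned {hn : 1 ≤ n} {σ : S} : (full hn σ).IsSigned :=
  ⟨_, mem_full_blocks.2 rfl, barImage_univ⟩

theorem leaders_full {hn : 1 ≤ n} {σ : S} : (full hn σ).leaders = ∅ := by
  rw [Finset.eq_empty_iff_forall_notMem]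
  intro v hv
  apply (mem_leaders.1 hv).1
  rw [mem_full_blocks.1 (block_mem _ v), barImage_univ]

variable [Unique S]

theorem signedBlock_full {hn : 1 ≤ n} {σ τ : S} : (full hn σ).signedBlock τ = Finset.univ :=
  signedBlock_of_barImage_eq (mem_full_blocks.2 rfl) barImage_univ τ

theorem le_full (x : LabeledPartition n S) {hn : 1 ≤ n} {σ : S} : x ≤ full hn σ :=
  le_iff_blocks.2 fun _ _ => ⟨_, mem_full_blocks.2 rfl, Finset.subset_univ _⟩

theorem eq_full {x : LabeledPartition n S} {hn : 1 ≤ n} {σ : S} (h : Finset.univ ∈ x.blocks) :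
    x = full hn σ :=
  le_antisymm x.le_full (le_iff_blocks.2 fun _ _ => ⟨_, h, Finset.subset_univ _⟩)

theorem eq_full_of_leaders_eq_empty {x : LabeledPartition n S} {hn : 1 ≤ n} {σ : S}
    (hx : x.IsSigned) (h : x.leaders = ∅) : x = full hn σ := by
  obtain ⟨B, hB, hBB⟩ := hx
  refine eq_full ?_
  convert hB
  rw [eq_comm, Finset.eq_univ_iff_forall]
  intro a
  obtain ⟨C, hC, haC⟩ := x.exists_block a
  by_cases hCC : barImage C = C
  · rwa [eq_of_barImage_eq hB hBB hC hCC]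
  · obtain ⟨v, hv, -⟩ := exists_leader hC hCC
    rw [h] at hv
    exact absurd hv (Finset.notMem_empty v)

theorem full_mem_typeD_iff {hn : 1 ≤ n} {σ : S} : full hn σ ∈ typeD n S ↔ n ≠ 1 := by
  simp only [typeD, Set.mem_ofPred_eq, signedBlock_full, Finset.card_univ, Fintype.card_prod,
    Fintype.card_fin, Fintype.card_bool]
  constructor
  · intro h hn'
    exact h σ (by lia)
  · intro h _
    lia

/-! ### Classification of the edges -/

variable [LinearOrder S]

/-- A coherent merge cannot fill `[[n]]`: the union of the blocks of two leaders misses the bar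
image of the first. The default label is excluded because the signed block grows. -/
theorem one_le_edgeLabel_full {z : LabeledPartition n S} {hn : 1 ≤ n} {σ : S}
    (hz : z < full hn σ) : toLex (1, 1) ≤ edgeLabel z (full hn σ) := by
  rcases edgeLabel_cases z (full hn σ) with ⟨u, hu, v, hv, huv, h, -⟩ | ⟨u, -, v, -, -, -, hl⟩ |
    ⟨-, hl⟩ | ⟨-, h, -⟩
  · exfalso
    rw [mem_full_blocks] at h
    rcases eq_or_eq_of_subset_union (z.block_mem u) (z.block_mem v)
      (barImage_mem_blocks (z.block_mem u)) (h ▸ Finset.subset_univ _) with h' | h'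
    · exact (mem_leaders.1 hu).1 h'
    · exact block_ne_barImage_block hv hu h'.symm
  · rw [hl, Prod.Lex.toLex_le_toLex]
    simp
  · exact hl.ge
  · refine absurd ⟨σ, ?_⟩ h
    rw [signedBlock_full, Finset.ssubset_univ_iff]
    intro h'
    by_cases hs : z.IsSigned
    · exact hz.ne (eq_full (h' ▸ hs.signedBlock_mem σ))
    · rw [signedBlock_eq_empty hs] at h'
      exact univ_ne_bot hn h'.symm

theorem edgeLabel_le (x y : LabeledPartition n S) : edgeLabel x y ≤ toLex (2, n) := by
  rcases edgeLabel_cases x y with ⟨u, -, v, -, -, -, m, h⟩ | ⟨u, -, v, -, -, -, h⟩ |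
    ⟨-, h⟩ | ⟨-, -, h⟩ <;> rw [h, Prod.Lex.toLex_le_toLex]
  · simp
  · exact Or.inr ⟨rfl, u.2⟩
  · simp
  · simp

theorem IsAbsorb.eq {x y z : typeD n S} {v : Fin n} (h : IsAbsorb x y v) (hxz : x ⋖ z)
    (hz : z.1.IsSigned) (hvz : x.1.block v ⊆ z.1.signedBlock default) : y = z :=
  eq_of_le_of_not_lt (h.le z hxz.le hz hvz) (hxz.2 h.covBy.lt)

/-- Complements `exists_isMerge` and `exists_isAbsorb`. Suppose `x` is unsigned and the signed block
of `y` swallows only singletons. The type $D$ condition forces two different indices, and merging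
their blocks non-coherently gives an element strictly between `x` and `y`. -/
theorem covBy_cases {x y : typeD n S} (hxy : x ⋖ y) (h1 : toLex (1, 1) ≤ edgeLabel x.1 y.1) :
    (∃ u ∈ x.1.leaders, ∃ v ∈ x.1.leaders, u < v ∧ x.1.mergedBlock u v ∈ y.1.blocks ∧
      edgeLabel x.1 y.1 = toLex (2, (u : ℕ) + 1)) ∨
    (edgeLabel x.1 y.1 = toLex (1, 1) ∧ y.1.IsSigned ∧ ∃ v ∈ x.1.leaders,
      (x.1.IsSigned ∨ v ∈ x.1.bigLeaders) ∧ x.1.block v ⊆ y.1.signedBlock default) := by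
  rcases edgeLabel_cases x.1 y.1 with ⟨u, -, v, -, -, -, m, hl⟩ | h | ⟨⟨σ, hσ⟩, hl⟩ | ⟨-, -, hl⟩
  · rw [hl, Prod.Lex.toLex_le_toLex] at h1
    simp at h1
  · exact Or.inl h
  · right
    obtain rfl := Subsingleton.elim default σ
    have hys : y.1.IsSigned := by
      by_contra hys
      rw [signedBlock_eq_empty hys] at hσ
      exact Finset.not_ssubset_empty _ hσ
    refine ⟨hl, hys, ?_⟩
    have hT := hys.signedBlock_mem default
    have hbar := y.1.barImage_signedBlock default
    have key : ∀ a ∈ y.1.signedBlock default, a ∉ x.1.signedBlock default → ∃ v ∈ x.1.leaders,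
        x.1.block v ⊆ y.1.signedBlock default ∧ (a ∈ x.1.block v ∨ a ∈ barImage (x.1.block v)) := by
      intro a ha hax
      obtain ⟨B, hB, haB⟩ := x.1.exists_block a
      have hBT := subset_of_le hxy.le hB hT haB ha
      obtain ⟨v, hv, rfl | rfl⟩ := exists_leader hB fun h => hax (by
        rwa [signedBlock_of_barImage_eq hB h])
      · exact ⟨v, hv, hBT, Or.inl haB⟩
      · rw [barImage_subset_iff, hbar] at hBT
        exact ⟨v, hv, hBT, Or.inr haB⟩
    obtain ⟨a, ha, hax⟩ := (Finset.ssubset_iff_of_subset hσ.subset).1 hσ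
    obtain ⟨v, hv, hvT, -⟩ := key a ha hax
    by_cases hx : x.1.IsSigned
    · exact ⟨v, hv, Or.inl hx, hvT⟩
    by_contra! hcon
    have hsing : ∀ w ∈ x.1.leaders, x.1.block w ⊆ y.1.signedBlock default →
        x.1.block w = {(w, false)} := by
      intro w hw hwT
      have hc : (x.1.block w).card = 1 := by
        by_contra hc
        exact hcon w hw (Or.inr (mem_bigLeaders.2 ⟨hw, hc⟩)) hwT
      obtain ⟨b, hb⟩ := Finset.card_eq_one.1 hc
      have := x.1.mem_block w
      rw [hb, Finset.mem_singleton] at this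
      rw [hb, this]
    -- Otherwise the signed block of `y` would be the forbidden pair formed by `v` and its barred
    -- copy.
    obtain ⟨b, hb, hbv⟩ : ∃ b ∈ y.1.signedBlock default, b.1 ≠ v := by
      by_contra! hall
      apply y.2 default
      have : y.1.signedBlock default = {(v, false), (v, true)} := by
        refine subset_antisymm (fun b hb => ?_) ?_
        · obtain ⟨w, c⟩ := b
          obtain rfl : w = v := hall _ hb
          cases c <;> simp
        · have h1 := hvT (x.1.mem_block v)
          have h2 : (v, true) ∈ y.1.signedBlock default := by
            rw [← hbar, mem_barImage]
            exact h1
          simp [Finset.insert_subset_iff, h1, h2]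
      rw [this, Finset.card_pair (by simp)]
    obtain ⟨w, hw, hwT, hbw⟩ := key b hb (by rw [signedBlock_eq_empty hx]; exact Finset.notMem_empty b)
    have hvw : v ≠ w := by
      rintro rfl
      rw [mem_barImage, hsing v hw hwT, Finset.mem_singleton, Finset.mem_singleton] at hbw
      rcases hbw with h | h
      · exact hbv (by rw [h])
      · exact hbv (congrArg Prod.fst h)
    -- The merge `z` is unsigned and `y` is signed, so `z` lies strictly below `y`.
    have hfalse : ∀ v ∈ x.1.leaders, ∀ w ∈ x.1.leaders, x.1.block v ⊆ y.1.signedBlock default →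
        x.1.block w ⊆ y.1.signedBlock default → ¬ v < w := by
      intro v hv w hw hvT hwT hvw
      obtain ⟨z, hz⟩ := exists_isMerge hx hv hw hvw
      have hzy : z ≤ y := hz.le y hxy.le _ hT (Finset.union_subset hvT
        (by rwa [barImage_subset_iff, hbar]))
      exact hxy.2 hz.covBy.lt (lt_of_le_of_ne hzy fun h => hz.not_isSigned (h ▸ hys))
    rcases hvw.lt_or_gt with h | h
    · exact hfalse v hv w hw hvT hwT h
    · exact hfalse w hw v hv hwT hvT h
  · rw [hl, Prod.Lex.toLex_le_toLex] at h1
    simp at h1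

end LabeledPartition

/-! ## Counting decreasing chains -/

theorem Set.encard_biUnion_finset {ι α : Type*} (s : Finset ι) (A : ι → Set α)
    (h : (s : Set ι).PairwiseDisjoint A) : (⋃ i ∈ s, A i).encard = ∑ i ∈ s, (A i).encard := by
  classical
  induction s using Finset.induction_on with
  | empty => simp
  | insert i s hi ih =>
    rw [Finset.set_biUnion_insert, Finset.sum_insert hi, Set.encard_union_eq, ih]
    · exact h.subset (by simp)
    · rw [Set.disjoint_iUnion₂_right]
      intro j hj
      exact h (by simp) (by simp [hj]) fun hij => hi (hij ▸ hj)

/-! ### Chains with bounded labels and their recursion -/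

namespace LabeledPartition

variable {n : ℕ} {S : Type*} [LinearOrder S]

/-- The decreasing maximal chains from `x` to `y` with labels at least `(1, 1)`, such that the first
label belongs to `J`. -/
def chainsFrom (y x : typeD n S) (J : Set (ℕ ×ₗ ℕ)) : Set (List (typeD n S)) :=
  {c | c.IsChain (fun a b => a ⋖ b) ∧ c.head? = some x ∧ c.getLast? = some y ∧
    (word (c.map Subtype.val)).Pairwise (fun a b => b ≤ a) ∧
    (∀ l ∈ word (c.map Subtype.val), toLex (1, 1) ≤ l) ∧
    ∀ l ∈ (word (c.map Subtype.val)).head?, l ∈ J}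

theorem word_cons_cons (a b : LabeledPartition n S) (c : List (LabeledPartition n S)) :
    word (a :: b :: c) = edgeLabel a b :: word (b :: c) := rfl

/-- For a decreasing word it is enough to compare neighbours, so the first label only restricts the
head of the remaining word. This is why `J` is part of the definition. -/
theorem cons_mem_chainsFrom {x y z : typeD n S} {c : List (typeD n S)} {J : Set (ℕ ×ₗ ℕ)} :
    x :: z :: c ∈ chainsFrom y x J ↔ x ⋖ z ∧ toLex (1, 1) ≤ edgeLabel x.1 z.1 ∧
      edgeLabel x.1 z.1 ∈ J ∧ z :: c ∈ chainsFrom y z (Set.Iic (edgeLabel x.1 z.1)) := by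
  simp only [chainsFrom, Set.mem_ofPred_eq, List.isChain_cons_cons, List.head?_cons, true_and,
    List.getLast?_cons_cons, List.map_cons, word_cons_cons, List.pairwise_cons, List.mem_cons,
    forall_eq_or_imp, Option.mem_def, Option.some.injEq, forall_eq']
  set W := word (z.1 :: c.map Subtype.val)
  constructor
  · rintro ⟨⟨h1, h2⟩, h3, ⟨h4, h5⟩, ⟨h6, h7⟩, h8⟩
    exact ⟨h1, h6, h8, h2, h3, h5, h7, fun l hl => h4 l (List.mem_of_mem_head? hl)⟩
  · rintro ⟨h1, h6, h8, h2, h3, h5, h7, h4⟩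
    refine ⟨⟨h1, h2⟩, h3, ⟨?_, h5⟩, ⟨h6, h7⟩, h8⟩
    match W, h4, h5 with
    | [], _, _ => simp
    | w :: W, h4, h5 =>
      intro l hl
      have hw : w ≤ edgeLabel x.1 z.1 := h4 w rfl
      rcases List.mem_cons.1 hl with rfl | hl
      · exact hw
      · exact ((List.pairwise_cons.1 h5).1 l hl).trans hw

theorem exists_eq_cons_of_mem_chainsFrom {x y : typeD n S} {c : List (typeD n S)}
    {J : Set (ℕ ×ₗ ℕ)} (h : c ∈ chainsFrom y x J) : ∃ c', c = x :: c' := by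
  obtain ⟨-, h, -⟩ := h
  match c, h with
  | a :: c, h =>
    obtain rfl : a = x := by simpa using h
    exact ⟨c, rfl⟩

theorem exists_eq_cons_cons_of_mem_chainsFrom {x y : typeD n S} (hxy : x ≠ y)
    {c : List (typeD n S)} {J : Set (ℕ ×ₗ ℕ)} (h : c ∈ chainsFrom y x J) :
    ∃ z c', c = x :: z :: c' := by
  obtain ⟨_ | ⟨z, c'⟩, rfl⟩ := exists_eq_cons_of_mem_chainsFrom h
  · obtain ⟨-, -, h, -⟩ := h
    exact absurd (by simpa using h) hxy
  · exact ⟨z, c', rfl⟩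

theorem encard_chainsFrom_self {y : typeD n S} (hy : ∀ z, ¬ y ⋖ z) (J : Set (ℕ ×ₗ ℕ)) :
    (chainsFrom y y J).encard = 1 := by
  rw [Set.encard_eq_one]
  refine ⟨[y], Set.eq_singleton_iff_unique_mem.2 ⟨?_, fun c hc => ?_⟩⟩
  · simp [chainsFrom, word]
  · obtain ⟨_ | ⟨z, c'⟩, rfl⟩ := exists_eq_cons_of_mem_chainsFrom hc
    · rfl
    · exact absurd (cons_mem_chainsFrom.1 hc).1 (hy z)

/-- Counts by the first edge: `g` lists each admissible cover of `x` once, and the chain shows it as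
its second element. -/
theorem encard_chainsFrom_eq_sum {x y : typeD n S} (hxy : x ≠ y) {J : Set (ℕ ×ₗ ℕ)} {ι : Type*}
    (s : Finset ι) (g : ι → typeD n S) (hg : Set.InjOn g s)
    (hcov : ∀ z, (x ⋖ z ∧ toLex (1, 1) ≤ edgeLabel x.1 z.1 ∧ edgeLabel x.1 z.1 ∈ J) ↔
      ∃ i ∈ s, g i = z) (f : ι → ℕ)
    (hf : ∀ i ∈ s, (chainsFrom y (g i) (Set.Iic (edgeLabel x.1 (g i).1))).encard = f i) :
    (chainsFrom y x J).encard = (∑ i ∈ s, f i : ℕ) := by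
  have h : chainsFrom y x J = ⋃ i ∈ s,
      (x :: ·) '' chainsFrom y (g i) (Set.Iic (edgeLabel x.1 (g i).1)) := by
    ext c
    simp only [Set.mem_iUnion, Set.mem_image, exists_prop]
    constructor
    · intro hc
      obtain ⟨z, c', rfl⟩ := exists_eq_cons_cons_of_mem_chainsFrom hxy hc
      obtain ⟨h1, h2, h3, h4⟩ := cons_mem_chainsFrom.1 hc
      obtain ⟨i, hi, rfl⟩ := (hcov z).1 ⟨h1, h2, h3⟩
      exact ⟨i, hi, _, h4, rfl⟩
    · rintro ⟨i, hi, c', hc', rfl⟩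
      obtain ⟨c'', rfl⟩ := exists_eq_cons_of_mem_chainsFrom hc'
      obtain ⟨h1, h2, h3⟩ := (hcov _).2 ⟨i, hi, rfl⟩
      exact cons_mem_chainsFrom.2 ⟨h1, h2, h3, hc'⟩
  rw [h, Set.encard_biUnion_finset, Nat.cast_sum]
  · refine Finset.sum_congr rfl fun i hi => ?_
    rw [(List.cons_injective).encard_image, hf i hi]
  · intro i hi j hj hij
    refine Set.disjoint_left.2 ?_
    rintro _ ⟨c, hc, rfl⟩ ⟨c', hc', h⟩
    obtain rfl : c' = c := List.cons_injective h
    have h1 := hc.2.1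
    rw [hc'.2.1] at h1
    exact hij (hg hi hj (Option.some_injective _ h1).symm)

/-- The case `x = y` is excluded: the one-element chain has an empty word and would be counted for
both sets. -/
theorem encard_chainsFrom_union {x y : typeD n S} (hxy : x ≠ y) {J J' : Set (ℕ ×ₗ ℕ)}
    (hJ : Disjoint J J') : (chainsFrom y x (J ∪ J')).encard =
      (chainsFrom y x J).encard + (chainsFrom y x J').encard := by
  rw [← Set.encard_union_eq]
  · congr 1
    ext c
    by_cases hc : ∃ z c', c = x :: z :: c'
    · obtain ⟨z, c', rfl⟩ := hc
      rw [Set.mem_union, cons_mem_chainsFrom, cons_mem_chainsFrom, cons_mem_chainsFrom]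
      constructor
      · rintro ⟨h1, h2, h3 | h3, h4⟩
        · exact Or.inl ⟨h1, h2, h3, h4⟩
        · exact Or.inr ⟨h1, h2, h3, h4⟩
      · rintro (⟨h1, h2, h3, h4⟩ | ⟨h1, h2, h3, h4⟩)
        · exact ⟨h1, h2, Or.inl h3, h4⟩
        · exact ⟨h1, h2, Or.inr h3, h4⟩
    · have h : ∀ J, c ∉ chainsFrom y x J := fun J h =>
        hc (exists_eq_cons_cons_of_mem_chainsFrom hxy h)
      simp [h]
  · refine Set.disjoint_left.2 fun c h1 h2 => ?_
    obtain ⟨z, c', rfl⟩ := exists_eq_cons_cons_of_mem_chainsFrom hxy h1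
    exact Set.disjoint_left.1 hJ (cons_mem_chainsFrom.1 h1).2.2.1 (cons_mem_chainsFrom.1 h2).2.2.1

/-! ### Two recursively defined functions -/

/-- The coefficient of the number of nonsingleton blocks in the number of chains. -/
def bigCoeff : ℕ → ℕ → ℕ
  | 0, m => (m - 1)!
  | i + 1, 0 => bigCoeff i 1
  | i + 1, m + 1 => m * bigCoeff (i + 1) m + bigCoeff i (m + 2)

/-- The number of chains, if there are no nonsingleton blocks. -/
def constCoeff : ℕ → ℕ → ℕ
  | 0, _ => 0
  | i + 1, 0 => constCoeff i 1
  | i + 1, m + 1 => (m + 1) * (constCoeff (i + 1) m + bigCoeff i (m + 1)) + constCoeff i (m + 2)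

/-- The recursion becomes $(m+1)N!+2(i+1)N!=(N+1)!$ with $N=m+2i+2$. The values `bigCoeff (i + 1) 0`
are not needed, since the recursion multiplies them by `0`. -/
theorem bigCoeff_mul (i m : ℕ) : bigCoeff i (m + 1) * (2 ^ i * i !) = (m + 2 * i)! := by
  induction i generalizing m with
  | zero => simp [bigCoeff]
  | succ i ih =>
    have key : ∀ m, bigCoeff i (m + 2) * (2 ^ (i + 1) * (i + 1)!) =
        2 * (i + 1) * (m + 1 + 2 * i)! := fun m => by
      rw [← ih (m + 1), Nat.factorial_succ, pow_succ]
      ring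
    induction m with
    | zero =>
      rw [bigCoeff, zero_mul, zero_add, key 0, show 0 + 2 * (i + 1) = (0 + 1 + 2 * i) + 1 by ring,
        Nat.factorial_succ]
      ring
    | succ m ihm =>
      rw [bigCoeff, add_mul, key, mul_assoc, ihm,
        show m + 1 + 2 * (i + 1) = (m + 2 * (i + 1)) + 1 by ring, Nat.factorial_succ,
        show m + 1 + 1 + 2 * i = m + 2 * (i + 1) by ring]
      ring

/-- Only $m=0$ is wanted in the end, but the recursion runs through all $m$. -/
theorem constCoeff_mul (i m : ℕ) :
    constCoeff (i + 1) m * (2 ^ i * i !) = (m + 2 * i)! * (i + m) := by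
  induction i generalizing m with
  | zero =>
    induction m with
    | zero => simp [constCoeff]
    | succ m ihm =>
      simp only [pow_zero, Nat.factorial_zero, mul_one, mul_zero, add_zero, zero_add] at ihm ⊢
      rw [constCoeff, zero_add, ihm, bigCoeff, constCoeff, Nat.factorial_succ,
        Nat.add_sub_cancel]
      ring
  | succ i ih =>
    have key : ∀ m, constCoeff (i + 1) m * (2 ^ (i + 1) * (i + 1)!) =
        2 * (i + 1) * ((m + 2 * i)! * (i + m)) := fun m => by
      rw [← ih m, Nat.factorial_succ, pow_succ]
      ring
    induction m with
    | zero =>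
      rw [constCoeff, key, show 0 + 2 * (i + 1) = (1 + 2 * i) + 1 by ring, Nat.factorial_succ]
      ring
    | succ m ihm =>
      rw [constCoeff, add_mul, key, mul_assoc, add_mul (constCoeff _ _), ihm, bigCoeff_mul,
        show m + 1 + 2 * (i + 1) = (m + 2 * (i + 1)) + 1 by ring, Nat.factorial_succ,
        show m + 2 + 2 * i = m + 2 * (i + 1) by ring]
      ring

/-- Uses $(2i)!=(2i-1)!!\,2^i\,i!$ with $i=n-1$. -/
theorem constCoeff_zero {n : ℕ} (hn : 1 ≤ n) : constCoeff n 0 = (2 * n - 3)‼ * (n - 1) := by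
  obtain ⟨i, rfl⟩ := Nat.exists_eq_add_of_le' hn
  have h := constCoeff_mul i 0
  rw [zero_add, add_zero, Nat.add_sub_cancel] at *
  have h2 : (2 * i)! = (2 * (i + 1) - 3)‼ * (2 ^ i * i !) := by
    rcases i with _ | i
    · rfl
    · rw [← Nat.doubleFactorial_two_mul, show 2 * (i + 1) = 2 * i + 1 + 1 by ring,
        Nat.factorial_eq_mul_doubleFactorial, mul_comm,
        show 2 * (i + 1 + 1) - 3 = 2 * i + 1 by lia]
  rw [h2] at h
  refine Nat.eq_of_mul_eq_mul_right (m := 2 ^ i * i !) (by positivity) ?_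
  rw [h]
  ring

end LabeledPartition

namespace LabeledPartition

variable {n : ℕ} {S : Type*}

/-- The index `v` is recovered as the leader that disappeared. -/
theorem injOn_of_leaders_eq_erase {x : LabeledPartition n S} {s : Finset (Fin n)}
    (hs : s ⊆ x.leaders) {g : Fin n → typeD n S}
    (hg : ∀ v ∈ s, (g v).1.leaders = x.leaders.erase v) : Set.InjOn g s := by
  intro v hv w hw hvw
  have h : x.leaders.erase v = x.leaders.erase w := by rw [← hg v hv, ← hg w hw, hvw]
  by_contra hne
  have h1 : v ∈ x.leaders.erase w := Finset.mem_erase.2 ⟨hne, hs hv⟩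
  rw [← h] at h1
  exact Finset.notMem_erase v _ h1

theorem ne_full_of_mem_leaders {x y : typeD n S} {hn : 1 ≤ n} {σ : S} (hy : y.1 = full hn σ)
    {v : Fin n} (hv : v ∈ x.1.leaders) : x ≠ y := by
  rintro rfl
  rw [hy, leaders_full] at hv
  exact Finset.notMem_empty v hv

variable [LinearOrder S] [Unique S]

/-! ### The chains that only enlarge the signed block -/

/-- Below the bound `(1, 1)` only absorptions remain; once there is a signed block they may come in
any order. -/
theorem encard_chainsFrom_of_isSigned {y : typeD n S} {hn : 1 ≤ n} {σ : S}
    (hy : y.1 = full hn σ) (m : ℕ) (x : typeD n S) (hx : x.1.IsSigned)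
    (hm : x.1.leaders.card = m) :
    (chainsFrom y x (Set.Iic (toLex (1, 1)))).encard = (m ! : ℕ) := by
  induction m generalizing x with
  | zero =>
    obtain rfl : x = y := Subtype.ext (by
      rw [hy]
      exact eq_full_of_leaders_eq_empty hx (Finset.card_eq_zero.1 hm))
    rw [encard_chainsFrom_self]
    · simp
    · intro z hxz
      have hzx : z.1 ≤ x.1 := by
        rw [hy]
        exact le_full _
      exact hxz.lt.not_ge hzx
  | succ m ih =>
    obtain ⟨v₀, hv₀⟩ := Finset.card_pos.1 (hm.symm ▸ Nat.succ_pos m : 0 < x.1.leaders.card)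
    have hex : ∀ v, ∃ z, v ∈ x.1.leaders → IsAbsorb x z v := fun v => by
      by_cases hv : v ∈ x.1.leaders
      · obtain ⟨z, hz⟩ := exists_isAbsorb hv (Or.inl hx)
        exact ⟨z, fun _ => hz⟩
      · exact ⟨x, fun h => absurd h hv⟩
    choose g hg using hex
    rw [encard_chainsFrom_eq_sum (ne_full_of_mem_leaders hy hv₀) x.1.leaders g
      (injOn_of_leaders_eq_erase subset_rfl fun v hv => (hg v hv).leaders) ?_ (fun _ => m !),
      Finset.sum_const, hm, smul_eq_mul, Nat.factorial_succ]
    · intro v hv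
      rw [(hg v hv).label]
      refine ih _ (hg v hv).isSigned ?_
      rw [(hg v hv).leaders, Finset.card_erase_of_mem hv, hm, Nat.add_sub_cancel]
    · intro z
      constructor
      · rintro ⟨h1, h2, h3⟩
        rcases covBy_cases h1 h2 with ⟨u, -, v, -, -, -, hl⟩ | ⟨hl, hz, v, hv, -, hvz⟩
        · rw [hl, Set.mem_Iic, Prod.Lex.toLex_le_toLex] at h3
          simp at h3
        · exact ⟨v, hv, (hg v hv).eq h1 hz hvz⟩
      · rintro ⟨v, hv, rfl⟩
        exact ⟨(hg v hv).covBy, (hg v hv).label.ge, (hg v hv).label.le⟩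

/-! ### The chains that start with non-coherent merges -/

/-- The bound `(2, 0)` separates `(1, 1)` from all merge labels, whose second entry is at least `1`.
The first absorption takes a nonsingleton block; the others follow in any order. -/
theorem encard_chainsFrom_zero {y : typeD n S} {hn : 1 ≤ n} {σ : S} (hy : y.1 = full hn σ)
    (x : typeD n S) (hx : ¬ x.1.IsSigned) :
    (chainsFrom y x (Set.Iic (toLex (2, 0)))).encard =
      (x.1.bigLeaders.card * (x.1.leaders.card - 1)! : ℕ) := by
  have hex : ∀ v, ∃ z, v ∈ x.1.bigLeaders → IsAbsorb x z v := fun v => by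
    by_cases hv : v ∈ x.1.bigLeaders
    · obtain ⟨z, hz⟩ := exists_isAbsorb (x.1.bigLeaders_subset hv) (Or.inr hv)
      exact ⟨z, fun _ => hz⟩
    · exact ⟨x, fun h => absurd h hv⟩
  choose g hg using hex
  have hxy : x ≠ y := by
    rintro rfl
    exact hx (hy ▸ full_isSigned)
  rw [encard_chainsFrom_eq_sum hxy x.1.bigLeaders g (injOn_of_leaders_eq_erase
    x.1.bigLeaders_subset fun v hv => (hg v hv).leaders) ?_ (fun _ => (x.1.leaders.card - 1)!),
    Finset.sum_const, smul_eq_mul]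
  · intro v hv
    rw [(hg v hv).label]
    refine encard_chainsFrom_of_isSigned hy _ _ (hg v hv).isSigned ?_
    rw [(hg v hv).leaders, Finset.card_erase_of_mem (x.1.bigLeaders_subset hv)]
  · intro z
    constructor
    · rintro ⟨h1, h2, h3⟩
      rcases covBy_cases h1 h2 with ⟨u, -, v, -, -, -, hl⟩ | ⟨hl, hz, v, -, hv, hvz⟩
      · rw [hl, Set.mem_Iic, Prod.Lex.toLex_le_toLex] at h3
        simp at h3
      · have hv := hv.resolve_left hx
        exact ⟨v, hv, (hg v hv).eq h1 hz hvz⟩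
    · rintro ⟨v, hv, rfl⟩
      refine ⟨(hg v hv).covBy, (hg v hv).label.ge, ?_⟩
      rw [(hg v hv).label, Set.mem_Iic, Prod.Lex.toLex_le_toLex]
      simp

theorem encard_chainsFrom_singleton {y : typeD n S} {hn : 1 ≤ n} {σ : S} (hy : y.1 = full hn σ)
    (x : typeD n S) (hx : ¬ x.1.IsSigned) {u : Fin n} (hu : u ∈ x.1.leaders) (f : Fin n → ℕ)
    (hf : ∀ v ∈ x.1.leaders, u < v → ∀ z, IsMerge x z u v →
      (chainsFrom y z (Set.Iic (toLex (2, (u : ℕ) + 1)))).encard = f v) :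
    (chainsFrom y x {toLex (2, (u : ℕ) + 1)}).encard =
      (∑ v ∈ x.1.leaders.filter (u < ·), f v : ℕ) := by
  have hex : ∀ v, ∃ z, v ∈ x.1.leaders.filter (u < ·) → IsMerge x z u v := fun v => by
    by_cases hv : v ∈ x.1.leaders.filter (u < ·)
    · obtain ⟨hv1, hv2⟩ := Finset.mem_filter.1 hv
      obtain ⟨z, hz⟩ := exists_isMerge hx hu hv1 hv2
      exact ⟨z, fun _ => hz⟩
    · exact ⟨x, fun h => absurd h hv⟩
  choose g hg using hex
  rw [encard_chainsFrom_eq_sum (ne_full_of_mem_leaders hy hu) (x.1.leaders.filter (u < ·)) g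
    (injOn_of_leaders_eq_erase (Finset.filter_subset _ _) fun v hv => (hg v hv).leaders) ?_ f]
  · intro v hv
    obtain ⟨hv1, hv2⟩ := Finset.mem_filter.1 hv
    rw [(hg v hv).label]
    exact hf v hv1 hv2 _ (hg v hv)
  · intro z
    constructor
    · rintro ⟨h1, h2, h3⟩
      rw [Set.mem_singleton_iff] at h3
      rcases covBy_cases h1 h2 with ⟨w, -, v, hv, hwv, hz, hl⟩ | ⟨hl, -⟩
      · rw [h3, EmbeddingLike.apply_eq_iff_eq, Prod.mk.injEq] at hl
        obtain rfl : u = w := Fin.ext (Nat.succ_injective hl.2)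
        have hv' := Finset.mem_filter.2 ⟨hv, hwv⟩
        exact ⟨v, hv', (hg v hv').eq h1 hz⟩
      · rw [h3, EmbeddingLike.apply_eq_iff_eq, Prod.mk.injEq] at hl
        exact absurd hl.1 (by simp)
    · rintro ⟨v, hv, rfl⟩
      refine ⟨(hg v hv).covBy, ?_, (hg v hv).label⟩
      rw [(hg v hv).label, Prod.Lex.toLex_le_toLex]
      simp

theorem Iic_toLex_succ (j : ℕ) : Set.Iic (toLex (2, j + 1) : ℕ ×ₗ ℕ) =
    Set.Iic (toLex (2, j)) ∪ {toLex (2, j + 1)} := by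
  ext l
  obtain ⟨⟨a, b⟩, rfl⟩ := toLex.surjective l
  simp only [Set.mem_union, Set.mem_Iic, Set.mem_singleton_iff, Prod.Lex.toLex_le_toLex,
    EmbeddingLike.apply_eq_iff_eq, Prod.mk.injEq]
  lia

/-- As `v` runs over the partners of a merge, each element of `t` is lost exactly once:
$t(c+1)-t=tc$. -/
theorem sum_ite_mem_pred {α : Type*} [DecidableEq α] (s t : Finset α) (hts : t ⊆ s)
    (c d : ℕ) (hs : s.card = c + 1) :
    ∑ v ∈ s, (t.card - if v ∈ t then 1 else 0) * d = t.card * c * d := by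
  rw [← Finset.sum_mul]
  congr 1
  have h : ∑ v ∈ s, (t.card - if v ∈ t then 1 else 0) + ∑ v ∈ s, (if v ∈ t then 1 else 0) =
      s.card * t.card := by
    rw [← Finset.sum_add_distrib, ← smul_eq_mul, ← Finset.sum_const]
    refine Finset.sum_congr rfl fun v hv => ?_
    split_ifs with h
    · exact Nat.sub_add_cancel (Finset.card_pos.2 ⟨v, h⟩)
    · rfl
  rw [Finset.sum_ite_mem, Finset.inter_eq_right.2 hts, ← Finset.card_eq_sum_ones, hs] at h
  lia

theorem card_filter_le_eq_add {n : ℕ} (T : Finset (Fin n)) (j : ℕ) :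
    (T.filter fun v : Fin n => j ≤ v).card = (T.filter fun v : Fin n => j + 1 ≤ v).card +
      (T.filter fun v : Fin n => (v : ℕ) + 1 = j + 1).card := by
  simp only [Finset.card_filter, ← Finset.sum_add_distrib]
  refine Finset.sum_congr rfl fun v _ => ?_
  split_ifs <;> lia

theorem card_filter_eq_one {n : ℕ} {T : Finset (Fin n)} {u : Fin n} (hu : u ∈ T) :
    (T.filter fun v : Fin n => (v : ℕ) + 1 = u + 1).card = 1 := by
  rw [Finset.card_eq_one]
  refine ⟨u, ?_⟩
  ext v
  rw [Finset.mem_filter, Finset.mem_singleton]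
  constructor
  · rintro ⟨-, h⟩
    exact Fin.ext (Nat.succ_injective h)
  · rintro rfl
    exact ⟨hu, rfl⟩

/-- The hypotheses describe `x` after merges with labels at least `(2, i)`. Each removed some `v`
beyond its `u`, where `i ≤ u + 1`, so all indices below `i` are still leaders and among them only `i
- 1` can be big. Another merge with label `(2, i)` makes `i - 1` big anyway, so its being big
already matters only for chains without such a merge; hence the last coefficient. For `i = 0` the
last filter is empty. -/
theorem encard_chainsFrom_Iic {y : typeD n S} {hn : 1 ≤ n} {σ : S} (hy : y.1 = full hn σ)
    (i : ℕ) (hi : i ≤ n) (m : ℕ) (x : typeD n S) (hx : ¬ x.1.IsSigned)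
    (hlead : ∀ v : Fin n, (v : ℕ) < i → v ∈ x.1.leaders)
    (hbig : ∀ v : Fin n, (v : ℕ) + 1 < i → v ∉ x.1.bigLeaders)
    (hm : (x.1.leaders.filter fun v : Fin n => i ≤ v).card = m) :
    (chainsFrom y x (Set.Iic (toLex (2, i)))).encard =
      ((x.1.bigLeaders.filter fun v : Fin n => i ≤ v).card * bigCoeff i m + constCoeff i m +
        (x.1.bigLeaders.filter fun v : Fin n => (v : ℕ) + 1 = i).card *
          bigCoeff (i - 1) (m + 1) : ℕ) := by
  induction i generalizing m x with
  | zero =>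
    simp only [zero_le, Finset.filter_true] at hm
    rw [encard_chainsFrom_zero hy x hx, hm]
    simp [bigCoeff, constCoeff]
  | succ j ihj =>
    set u : Fin n := ⟨j, hi⟩ with hu
    -- Either the label `(2, j + 1)` is not used again, and `u` joins the `m` leaders beyond it as
    -- one more, or it is the next label.
    have hsplit : ∀ (m : ℕ) (x : typeD n S), ¬ x.1.IsSigned →
        (∀ v : Fin n, (v : ℕ) < j + 1 → v ∈ x.1.leaders) →
        (∀ v : Fin n, (v : ℕ) + 1 < j + 1 → v ∉ x.1.bigLeaders) →
        (x.1.leaders.filter fun v : Fin n => j + 1 ≤ v).card = m →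
        (chainsFrom y x (Set.Iic (toLex (2, j + 1)))).encard =
          (((x.1.bigLeaders.filter fun v : Fin n => j + 1 ≤ v).card +
            (x.1.bigLeaders.filter fun v : Fin n => (v : ℕ) + 1 = j + 1).card) *
              bigCoeff j (m + 1) + constCoeff j (m + 1) : ℕ) +
          (chainsFrom y x {toLex (2, (u : ℕ) + 1)}).encard := by
      intro m x hx hlead hbig hm
      have hxy : x ≠ y := by
        rintro rfl
        exact hx (hy ▸ full_isSigned)
      rw [Iic_toLex_succ, encard_chainsFrom_union hxy, ihj (Nat.le_of_succ_le hi) (m + 1) x hx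
        (fun v hv => hlead v (Nat.lt_succ_of_lt hv)) (fun v hv => hbig v (Nat.lt_succ_of_lt hv)),
        card_filter_le_eq_add, Finset.filter_false_of_mem (p := fun v : Fin n => (v : ℕ) + 1 = j)]
      · rw [Finset.card_empty, zero_mul, add_zero]
      · intro v hv h
        exact hbig v (by lia) hv
      · rw [card_filter_le_eq_add, hm]
        exact congrArg _ (card_filter_eq_one (hlead u (Nat.lt_succ_self j)))
      · rw [Set.disjoint_singleton_right, Set.mem_Iic, Prod.Lex.toLex_le_toLex]
        simp
    induction m generalizing x with
    | zero =>
      have huL : u ∈ x.1.leaders := hlead u (Nat.lt_succ_self j)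
      rw [hsplit 0 x hx hlead hbig hm,
        encard_chainsFrom_singleton (u := u) hy x hx huL (fun _ => 0)]
      · have hT : x.1.bigLeaders.filter (fun v : Fin n => j + 1 ≤ v) = ∅ :=
          Finset.subset_empty.1 ((Finset.filter_subset_filter _ x.1.bigLeaders_subset).trans
            (Finset.card_eq_zero.1 hm).subset)
        rw [hT, ← Nat.cast_add]
        congr 1
        simp [constCoeff]
        ring
      · intro v hv huv
        exact absurd (Finset.mem_filter.2 ⟨hv, huv⟩)
          (Finset.card_eq_zero.1 hm ▸ Finset.notMem_empty v)
    | succ m ihm =>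
      have huL : u ∈ x.1.leaders := hlead u (Nat.lt_succ_self j)
      set T := x.1.bigLeaders.filter fun v : Fin n => j + 1 ≤ v with hT
      -- After a merge with `v`, the set `T` loses `v` if it contained it, and `u` is big, whence
      -- the extra `bigCoeff j (m + 1)`.
      rw [hsplit (m + 1) x hx hlead hbig hm, encard_chainsFrom_singleton (u := u) hy x hx huL
        (fun v => (T.card - if v ∈ T then 1 else 0) * bigCoeff (j + 1) m +
          (constCoeff (j + 1) m + bigCoeff j (m + 1)))]
      · have hTs : T ⊆ x.1.leaders.filter (u < ·) :=
          Finset.filter_subset_filter _ x.1.bigLeaders_subset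
        have hm' : (x.1.leaders.filter (u < ·)).card = m + 1 := hm
        rw [Finset.sum_add_distrib, sum_ite_mem_pred _ T hTs m _ hm', Finset.sum_const, hm',
          ← Nat.cast_add, bigCoeff, constCoeff, smul_eq_mul, Nat.add_sub_cancel]
        congr 1
        ring
      · intro v hv huv z hz
        have huv' : j + 1 ≤ (v : ℕ) := huv
        rw [ihm z hz.not_isSigned, hz.bigLeaders, card_filter_eq_one (Finset.mem_insert_self u _),
          Finset.filter_insert, if_neg (by simp [hu]), Finset.filter_erase, ← hT,
          Finset.card_erase_eq_ite, Nat.add_sub_cancel]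
        · congr 1
          split_ifs
          · ring
          · rw [Nat.sub_zero]
            ring
        · intro w hw
          rw [hz.leaders]
          exact Finset.mem_erase.2 ⟨by rintro rfl; lia, hlead w hw⟩
        · intro w hw
          rw [hz.bigLeaders, Finset.mem_insert, Finset.mem_erase, not_or]
          exact ⟨by rintro rfl; simp [hu] at hw, fun h => hbig w hw h.2⟩
        · rw [hz.leaders, Finset.filter_erase,
            Finset.card_erase_of_mem (Finset.mem_filter.2 ⟨hv, huv'⟩), hm, Nat.add_sub_cancel]

/-! ### All decreasing chains -/

/-- The last label is at least `(1, 1)` by `one_le_edgeLabel_full`, and the labels decrease towards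
it. -/
theorem one_le_of_mem_word {y : typeD n S} {hn : 1 ≤ n} {σ : S} (hy : y.1 = full hn σ) :
    ∀ c : List (typeD n S), c.IsChain (fun a b => a ⋖ b) → c.getLast? = some y →
      (word (c.map Subtype.val)).Pairwise (fun a b => b ≤ a) →
      ∀ l ∈ word (c.map Subtype.val), toLex (1, 1) ≤ l
  | [], _, h, _ => by simp at h
  | [a], _, _, _ => by simp [word]
  | [a, b], hc, hlast, _ => by
    obtain rfl : b = y := by simpa using hlast
    have hab : a.1 < b.1 := (List.isChain_cons_cons.1 hc).1.lt
    rw [hy] at hab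
    intro l hl
    obtain rfl : l = edgeLabel a.1 b.1 := by simpa [word] using hl
    rw [hy]
    exact one_le_edgeLabel_full hab
  | a :: b :: d :: c, hc, hlast, hw => by
    have hw' := List.pairwise_cons.1 hw
    have ih := one_le_of_mem_word hy (b :: d :: c) (List.isChain_cons_cons.1 hc).2
      (by simpa using hlast) hw'.2
    intro l hl
    rcases List.mem_cons.1 hl with rfl | hl
    · exact (ih _ List.mem_cons_self).trans (hw'.1 _ List.mem_cons_self)
    · exact ih l hl

theorem encard_decreasingMaximalChains (hn : 1 ≤ n) (σ : S) :
    (decreasingMaximalChains (typeD n S) (zeroHat n S) (full hn σ)).encard =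
      ((2 * n - 3)‼ * (n - 1) : ℕ) := by
  by_cases hn1 : n = 1
  · subst hn1
    rw [Nat.sub_self, mul_zero, Nat.cast_zero, Set.encard_eq_zero, Set.eq_empty_iff_forall_notMem]
    rintro c ⟨-, -, h, -⟩
    rw [List.getLast?_map, Option.map_eq_some_iff] at h
    obtain ⟨y, -, hy⟩ := h
    exact full_mem_typeD_iff.1 (hy ▸ y.2) rfl
  · let x₀ : typeD n S := ⟨zeroHat n S, mem_typeD_of_not_isSigned not_isSigned_zeroHat⟩
    let y₀ : typeD n S := ⟨full hn σ, full_mem_typeD_iff.2 hn1⟩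
    have h : decreasingMaximalChains (typeD n S) (zeroHat n S) (full hn σ) =
        chainsFrom y₀ x₀ (Set.Iic (toLex (2, n))) := by
      ext c
      simp only [decreasingMaximalChains, chainsFrom, Set.mem_ofPred_eq, List.head?_map,
        List.getLast?_map, Option.map_eq_some_iff]
      constructor
      · rintro ⟨h1, ⟨x, hx, hx'⟩, ⟨y, hy, hy'⟩, h4⟩
        obtain rfl : x = x₀ := Subtype.ext hx'
        obtain rfl : y = y₀ := Subtype.ext hy'
        refine ⟨h1, hx, hy, h4, one_le_of_mem_word (hn := hn) (σ := σ) rfl c h1 hy h4, fun l hl => ?_⟩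
        match c, hl with
        | a :: b :: c, hl =>
          obtain rfl : edgeLabel a.1 b.1 = l := by simpa [word] using hl
          exact edgeLabel_le _ _
      · rintro ⟨h1, h2, h3, h4, -⟩
        exact ⟨h1, ⟨_, h2, rfl⟩, ⟨_, h3, rfl⟩, h4⟩
    have h0 : x₀.1.bigLeaders = ∅ := bigLeaders_zeroHat
    have h1 : x₀.1.leaders = Finset.univ := leaders_zeroHat
    -- At the bottom every index is a leader and none is big, so with `i = n` and `m = 0` only
    -- `constCoeff n 0` survives.
    rw [h, encard_chainsFrom_Iic (y := y₀) (hn := hn) (σ := σ) rfl n le_rfl 0 x₀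
      not_isSigned_zeroHat, h0, constCoeff_zero hn]
    · simp
    · simp [h1]
    · simp [h0]
    · rw [Finset.card_eq_zero, Finset.filter_eq_empty_iff]
      exact fun v _ => not_le.2 v.2

end LabeledPartition

theorem mainTheorem8 {S : Type*} [LinearOrder S] [Unique S] (σ : S) :
    (∀ n : ℕ, {T : IncreasingOrderedTree n | T.IsFlourishing 1}.encard =
      (chainFormula n linearDWeight : ℕ)) ∧
    (∀ (n : ℕ) (hn : 1 ≤ n),
      (LabeledPartition.decreasingMaximalChains (LabeledPartition.typeD n S)
        (LabeledPartition.zeroHat n S) (LabeledPartition.full hn σ)).encard =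
      ((2 * n - 3)‼ * (n - 1) : ℕ)) :=
  ⟨fun n => by rw [IncreasingOrderedTree.encard_flourishing, chainFormula_linearDWeight],
    fun _ hn => LabeledPartition.encard_decreasingMaximalChains hn σ⟩
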